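/- Let $N\ge 3$ be an integer and $1<p<N$. Let $V:(0,\infty)\to[0,+\infty]$ be a measurable function with $V\in L^1((r_1,r_2))$ for some $r_2>r_1>0$, and let $K:(0,\infty)\to(0,\infty)$ be a measurable function with $K\in L^s_{\mathrm{loc}}((0,\infty))$ for some $s>1$. Let $D^{1,p}(\mathbb R^N)=\{u\in L^{p^*}(\mathbb R^N):\nabla u\in L^p(\mathbb R^N)\}$, $p^*=\frac{pN}{N-p}$, with $\nabla u$ the weak gradient, and put $$W=D^{1,p}(\mathbb R^N)\cap L^p(\mathbb R^N,V(|x|)dx),\qquad \|u\|^p=\int_{\mathbb R^N}\bigl(|\nabla u|^p+V(|x|)|u|^p\bigr)dx ,$$ and let $W_r$ be the subspace of radial functions in $W$. For $q>1$ and $R>0$, with $B_R=\{x\in\mathbb R^N:|x|<R\}$, let $$\mathcal R_0(q,R)=\sup_{u\in W_r,\ h\in W,\ \|u\|=\|h\|=1}\ \int_{B_R}K(|x|)\,|u|^{q-1}|h|\,dx\in[0,+\infty].$$ For $\alpha,\beta,\gamma\in\mathbb R$ put $$q_*=q_*(\alpha,\beta,\gamma)=p\,\frac{\alpha-\gamma\beta+N}{N-\gamma},\qquad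 q_{**}=q_{**}(\alpha,\beta,\gamma)=p\,\frac{p\alpha+(1-p\beta)\gamma+p(N-1)}{p(N-1)-\gamma(p-1)}$$ (undefined for $\gamma=N$ and for $\gamma=\frac{p}{p-1}(N-1)$ respectively; note $N<\frac{p}{p-1}(N-1)$). For $\beta\in[0,1]$ and $\gamma\ge p$ let $\mathcal A_{\beta,\gamma}$ be the set of all $(\alpha,q)\in\mathbb R^2$ such that - $\max\{1,p\beta\}<q<\min\{q_*,q_{**}\}$, if $p\le\gamma<N$; - $\max\{1,p\beta\}<q<q_{**}$ and $\alpha>-(1-\beta)N$, if $\gamma=N$; - $\max\{1,p\beta,q_*\}<q<q_{**}$, if $N<\gamma<\frac{p}{p-1}(N-1)$; - $\max\{1,p\beta,q_*\}<q$ and $\alpha>-(1-\beta)\gamma$, if $\gamma=\frac{p}{p-1}(N-1)$; - $\max\{1,p\beta,q_*,q_{**}\}<q$, if $\gamma>\frac{p}{p-1}(N-1)$. **Theorem.** Assume that there exists $R_1>0$ such that $V(r)<+\infty$ for almost every $r\in(0,R_1)$, $$\operatorname*{ess\,sup}_{r\in(0,R_1)}\frac{K(r)}{r^{\alpha_0}V(r)^{\beta_0}}<+\infty\quad\text{for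 some }0\le\beta_0\le1\text{ and }\alpha_0\in\mathbb R$$ (with $V(r)^0=1$), and $$\operatorname*{ess\,inf}_{r\in(0,R_1)}r^{\gamma_0}V(r)>0\quad\text{for some }\gamma_0\ge p.$$ Then $\displaystyle\lim_{R\to0^+}\mathcal R_0(q_1,R)=0$ for every $q_1\in\mathbb R$ such that $(\alpha_0,q_1)\in\mathcal A_{\beta_0,\gamma_0}$. -/

import Mathlib

open MeasureTheory Set Filter Topology
open scoped ENNReal ContDiff

noncomputable section

namespace RadialCompactness

/-- The Euclidean space `ℝ^N`. -/
abbrev Eucl (N : ℕ) : Type := EuclideanSpace ℝ (Fin N)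

/-- Hypothesis `(V)`: `V : (0,∞) → [0,∞]` is (Lebesgue) measurable and belongs to `L¹((r₁,r₂))`
for some `0 < r₁ < r₂`. Only the values of `V` on `(0,∞)` matter. -/
structure HypV (V : ℝ → ℝ≥0∞) : Prop where
  aemeasurable : AEMeasurable V (volume.restrict (Ioi 0))
  integrable : ∃ r₁ r₂ : ℝ, 0 < r₁ ∧ r₁ < r₂ ∧ ∫⁻ r in Ioo r₁ r₂, V r < ⊤

/-- Hypothesis `(K)`: `K : (0,∞) → (0,∞)` is (Lebesgue) measurable and belongs to
`L^s_loc((0,∞))` for some `s > 1`. Only the values of `K` on `(0,∞)` matter. -/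
structure HypK (K : ℝ → ℝ) : Prop where
  aemeasurable : AEMeasurable K (volume.restrict (Ioi 0))
  pos : ∀ r : ℝ, 0 < r → 0 < K r
  locallyMemLp : ∃ s : ℝ, 1 < s ∧
    ∀ C : Set ℝ, IsCompact C → C ⊆ Ioi 0 → MemLp K (ENNReal.ofReal s) (volume.restrict C)

/-- `g` is a weak (distributional) gradient of `u` on `ℝ^N`. -/
structure HasWeakGradient {N : ℕ} (u : Eucl N → ℝ) (g : Eucl N → Eucl N) : Prop where
  locallyIntegrable : LocallyIntegrable u
  locallyIntegrable_gradient : LocallyIntegrable g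
  integral_eq : ∀ φ : Eucl N → ℝ, ContDiff ℝ ∞ φ → HasCompactSupport φ → ∀ i : Fin N,
    ∫ x, u x * fderiv ℝ φ x (EuclideanSpace.single i 1) = -∫ x, g x i * φ x

open Classical in
/-- The weak gradient `∇u` (unique up to null sets); it is `0` by convention if `u` has none. -/
def weakGradient {N : ℕ} (u : Eucl N → ℝ) : Eucl N → Eucl N :=
  if h : ∃ g, HasWeakGradient u g then h.choose else 0

/-- `D^{1,p}(ℝ^N) = {u ∈ L^{p*} : ∇u ∈ L^p}`, where `p* = pN/(N-p)`. -/
def D1p (N : ℕ) (p : ℝ) : Set (Eucl N → ℝ) :=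
  {u | MemLp u (ENNReal.ofReal (p * N / (N - p))) ∧ (∃ g, HasWeakGradient u g) ∧
    MemLp (weakGradient u) (ENNReal.ofReal p)}

/-- `u` is radial: it coincides almost everywhere with a measurable function of `|x|`. -/
def IsRadial {N : ℕ} (u : Eucl N → ℝ) : Prop :=
  ∃ f : ℝ → ℝ, Measurable f ∧ u =ᵐ[volume] fun x => f ‖x‖

/-- `W = D^{1,p}(ℝ^N) ∩ L^p(ℝ^N, V(|x|)dx)`. -/
def W (N : ℕ) (p : ℝ) (V : ℝ → ℝ≥0∞) : Set (Eucl N → ℝ) :=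
  {u | u ∈ D1p N p ∧ ∫⁻ x, V ‖x‖ * ‖u x‖ₑ ^ p < ⊤}

/-- `W_r`, the subspace of the radial functions of `W`. -/
def Wr (N : ℕ) (p : ℝ) (V : ℝ → ℝ≥0∞) : Set (Eucl N → ℝ) :=
  {u | u ∈ W N p V ∧ IsRadial u}

/-- The norm of `W`: `‖u‖^p = ∫ (|∇u|^p + V(|x|)|u|^p) dx`. It is finite for `u ∈ W`. -/
def wNorm {N : ℕ} (p : ℝ) (V : ℝ → ℝ≥0∞) (u : Eucl N → ℝ) : ℝ≥0∞ :=
  (∫⁻ x, (‖weakGradient u x‖ₑ ^ p + V ‖x‖ * ‖u x‖ₑ ^ p)) ^ (1 / p)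

/-- `R₀(q,R)`: the supremum of `∫_{B_R} K(|x|)|u|^{q-1}|h| dx` over `u ∈ W_r` and `h ∈ W` with
`‖u‖ = ‖h‖ = 1`; it may be infinite. -/
def R0 (N : ℕ) (p : ℝ) (V : ℝ → ℝ≥0∞) (K : ℝ → ℝ) (q R : ℝ) : ℝ≥0∞ :=
  ⨆ (u : Eucl N → ℝ) (h : Eucl N → ℝ) (_ : u ∈ Wr N p V) (_ : h ∈ W N p V)
    (_ : wNorm p V u = 1) (_ : wNorm p V h = 1),
    ∫⁻ x in Metric.ball (0 : Eucl N) R, ENNReal.ofReal (K ‖x‖) * ‖u x‖ₑ ^ (q - 1) * ‖h x‖ₑ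

/-- `q_*(α,β,γ)`, only meaningful for `γ ≠ N`. -/
def qStar (N : ℕ) (p α β γ : ℝ) : ℝ :=
  p * ((α - γ * β + N) / (N - γ))

/-- `q_{**}(α,β,γ)`, only meaningful for `γ ≠ p(N-1)/(p-1)`. -/
def qStarStar (N : ℕ) (p α β γ : ℝ) : ℝ :=
  p * ((p * α + (1 - p * β) * γ + p * (N - 1)) / (p * (N - 1) - γ * (p - 1)))

/-- The region `A_{β,γ}` of the `αq`-plane (for `γ ≥ p`). -/
def regionA (N : ℕ) (p β γ : ℝ) : Set (ℝ × ℝ) :=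
  {x | let α := x.1
       let q := x.2
       (p ≤ γ ∧ γ < N ∧
          max 1 (p * β) < q ∧ q < min (qStar N p α β γ) (qStarStar N p α β γ)) ∨
       (γ = N ∧
          max 1 (p * β) < q ∧ q < qStarStar N p α β γ ∧ -(1 - β) * N < α) ∨
       (N < γ ∧ γ < p / (p - 1) * (N - 1) ∧
          max (max 1 (p * β)) (qStar N p α β γ) < q ∧ q < qStarStar N p α β γ) ∨
       (γ = p / (p - 1) * (N - 1) ∧
          max (max 1 (p * β)) (qStar N p α β γ) < q ∧ -(1 - β) * γ < α) ∨
       (p / (p - 1) * (N - 1) < γ ∧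
          max (max (max 1 (p * β)) (qStar N p α β γ)) (qStarStar N p α β γ) < q)}

end RadialCompactness

end

/-! Near the origin `K` is at most a constant times `|x|^α V^β`. Since `|x|^γ V` is bounded below
there, multiplying by `(|x|^γ V)^θ` with `θ ≥ 0` costs only a constant, so the power of `V` can be
raised at will (`le_rpow_mul_rpow_add`). It is raised until `V` is absorbed by the integrals of
`V|u|^p` and `V|h|^p`, both at most `1`; a power of `|x|` remains, and its exponent decides the
limit.

If `q < p`, the power of `V` is raised to `q/p` and Hölder's inequality with exponents `p/(p-q)`,
`p/(q-1)`, `p` leaves a power of the integral of `|x|^τ` over `B_R`. The inequality attached to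
`q_*` says exactly that `τ > -N`. Radial symmetry plays no role here.

If `q ≥ p`, the power of `V` is raised to `1` and `|u|^(q-1)` is split as `|u|^(q-p) |u|^(p-1)`. The
first factor is controlled by a radial lemma, `|u|^p ≤ C |x|^(-κ)` with `κ = N-1-γ(p-1)/p`. The
inequality attached to `q_**` says exactly that the remaining exponent of `|x|` is positive. All
five cases of `regionA` imply both inequalities once denominators are cleared.

The radial lemma integrates the derivative of `r^κ |f|^p`, where `f` is the radial profile of `u`.
For this `f` must be absolutely continuous. Testing the weak gradient against radial vector fields
shows that the weak derivative of `f` is the spherical mean of the radial component of the gradient,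
which avoids having to know that the gradient is itself radial. The du Bois-Reymond lemma then makes
`f` a primitive of this mean. -/

namespace RadialCompactness

/-! ### Weak derivatives on the half-line -/

/-- A compact subset of the half-line lies in a bounded interval around `1`, away from `0`. -/
theorem exists_subset_Ioo_of_isCompact {S : Set ℝ} (hS : IsCompact S) (hpos : S ⊆ Ioi 0) :
    ∃ a b : ℝ, 0 < a ∧ a < 1 ∧ 1 < b ∧ S ⊆ Ioo a b := by
  have h1 : IsCompact (insert 1 S) := hS.insert 1
  have hne : (insert 1 S).Nonempty := ⟨1, mem_insert _ _⟩
  obtain ⟨m, hm, hmin⟩ := h1.exists_isLeast hne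
  obtain ⟨M, hM, hmax⟩ := h1.exists_isGreatest hne
  have hm0 : 0 < m := by
    rcases hm with rfl | hm
    · exact one_pos
    · exact hpos hm
  have hm1 : m ≤ 1 := hmin (mem_insert _ _)
  have hM1 : 1 ≤ M := hmax (mem_insert _ _)
  refine ⟨m / 2, M + 1, by linarith, by linarith, by linarith, fun x hx => ⟨?_, ?_⟩⟩
  · have := hmin (mem_insert_of_mem _ hx)
    linarith
  · have := hmax (mem_insert_of_mem _ hx)
    linarith

theorem intervalIntegrable_of_locallyIntegrableOn_Ioi {G : ℝ → ℝ}
    (hG : LocallyIntegrableOn G (Ioi 0)) {a b : ℝ} (ha : 0 < a) (hb : 0 < b) :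
    IntervalIntegrable G volume a b := by
  have hsub : uIcc a b ⊆ Ioi 0 := fun x hx => lt_of_lt_of_le (lt_min ha hb) hx.1
  exact (hG.integrableOn_compact_subset hsub isCompact_uIcc).intervalIntegrable

/-- Integration by parts of a primitive against a test function. -/
theorem integral_primitive_mul_deriv {G : ℝ → ℝ} (hG : LocallyIntegrableOn G (Ioi 0))
    {η : ℝ → ℝ} (hη : ContDiff ℝ ∞ η) (hc : HasCompactSupport η) (hs : tsupport η ⊆ Ioi 0) :
    ∫ r, (∫ t in (1:ℝ)..r, G t) * deriv η r = -∫ r, G r * η r := by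
  obtain ⟨a, b, ha, ha1, hb1, hab⟩ := exists_subset_Ioo_of_isCompact hc hs
  have hle : a ≤ b := by linarith
  have hGi : IntervalIntegrable G volume a b :=
    intervalIntegrable_of_locallyIntegrableOn_Ioi hG ha (by linarith)
  have hF := hGi.absolutelyContinuousOnInterval_intervalIntegral (c := 1)
    (by rw [uIcc_of_le hle]; constructor <;> linarith)
  have hηac : AbsolutelyContinuousOnInterval η a b :=
    ContDiffOn.absolutelyContinuousOnInterval (hη.of_le (by norm_cast)).contDiffOn
  have hib := hF.integral_mul_deriv_eq_deriv_mul hηac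
  have hna : η a = 0 := image_eq_zero_of_notMem_tsupport fun h => lt_irrefl _ (hab h).1
  have hnb : η b = 0 := image_eq_zero_of_notMem_tsupport fun h => lt_irrefl _ (hab h).2
  have e1 : ∫ r, (∫ t in (1:ℝ)..r, G t) * deriv η r
      = ∫ r in a..b, (∫ t in (1:ℝ)..r, G t) * deriv η r := by
    rw [intervalIntegral.integral_eq_integral_of_support_subset]
    intro x hx
    have : x ∈ tsupport η := by
      by_contra h
      have h2 : x ∉ tsupport (deriv η) := fun h' => h ((tsupport_deriv_subset (f := η)) h')
      exact hx (by simp [image_eq_zero_of_notMem_tsupport h2])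
    exact Ioo_subset_Ioc_self (hab this)
  have e2 : ∫ r, G r * η r = ∫ r in a..b, G r * η r := by
    rw [intervalIntegral.integral_eq_integral_of_support_subset]
    intro x hx
    have : x ∈ tsupport η := by
      by_contra h
      exact hx (by simp [image_eq_zero_of_notMem_tsupport h])
    exact Ioo_subset_Ioc_self (hab this)
  rw [e1, e2, hib, hna, hnb]
  simp only [mul_zero, sub_zero, zero_sub, neg_inj]
  apply intervalIntegral.integral_congr_ae
  filter_upwards [hGi.ae_hasDerivAt_integral] with x hx hx'
  rw [(hx (uIoc_subset_uIcc hx') 1 (by rw [uIcc_of_le hle]; constructor <;> linarith)).deriv]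

/-- The lemma of du Bois-Reymond on the half-line. -/
theorem exists_ae_eq_const_of_integral_mul_deriv_eq_zero {h : ℝ → ℝ}
    (hh : LocallyIntegrableOn h (Ioi 0))
    (H : ∀ η : ℝ → ℝ, ContDiff ℝ ∞ η → HasCompactSupport η → tsupport η ⊆ Ioi 0 →
      ∫ r, h r * deriv η r = 0) :
    ∃ c : ℝ, ∀ᵐ r, r ∈ Ioi (0:ℝ) → h r = c := by
  let b : ContDiffBump (1:ℝ) := ⟨1/4, 1/2, by norm_num, by norm_num⟩
  have hint : ∀ φ : ℝ → ℝ, Continuous φ → HasCompactSupport φ → tsupport φ ⊆ Ioi 0 →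
      Integrable fun r => h r * φ r := by
    intro φ hφ hφc hφs
    have h1 := (hh.integrableOn_compact_subset hφs hφc).mul_continuousOn hφ.continuousOn hφc
    refine (integrableOn_iff_integrable_of_support_subset ?_).1 h1
    intro x hx
    by_contra hx'
    exact hx (by simp [image_eq_zero_of_notMem_tsupport hx'])
  set φ₀ : ℝ → ℝ := b.normed volume with hφ₀
  have h0d : ContDiff ℝ ∞ φ₀ := b.contDiff_normed
  have h0c : HasCompactSupport φ₀ := b.hasCompactSupport_normed
  have h0s : tsupport φ₀ ⊆ Ioi 0 := by
    rw [hφ₀, b.tsupport_normed_eq]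
    intro x hx
    rw [Metric.mem_closedBall, Real.dist_eq, abs_le] at hx
    have : b.rOut = 1/2 := rfl
    rw [this] at hx
    rw [mem_Ioi]
    linarith [hx.1]
  have h0i : ∫ x, φ₀ x = 1 := b.integral_normed
  set c := ∫ r, h r * φ₀ r with hcdef
  refine ⟨c, ?_⟩
  have key : ∀ φ : ℝ → ℝ, ContDiff ℝ ∞ φ → HasCompactSupport φ → tsupport φ ⊆ Ioi 0 →
      ∫ r, φ r • (h r - c) = 0 := by
    intro φ hφ hφc hφs
    set I := ∫ x, φ x with hI
    -- Removing the mass of `φ` with the normalized bump gives `ψ` zero integral, so its primitive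
    -- `η` vanishes beyond the support and is an admissible test function.
    set ψ : ℝ → ℝ := fun x => φ x - I * φ₀ x with hψ
    have hψd : ContDiff ℝ ∞ ψ := hφ.sub (contDiff_const.mul h0d)
    have hcont : Continuous ψ := hψd.continuous
    have hφi : Integrable φ := hφ.continuous.integrable_of_hasCompactSupport hφc
    have h0int : Integrable φ₀ := h0d.continuous.integrable_of_hasCompactSupport h0c
    obtain ⟨a, b', ha, ha1, hb1, hab⟩ := exists_subset_Ioo_of_isCompact (hφc.union h0c)
      (union_subset hφs h0s)
    have hψ0 : ∀ x, x ∉ Ioo a b' → ψ x = 0 := by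
      intro x hx
      have hx' : x ∉ tsupport φ ∪ tsupport φ₀ := fun h => hx (hab h)
      rw [mem_union, not_or] at hx'
      simp [hψ, image_eq_zero_of_notMem_tsupport hx'.1, image_eq_zero_of_notMem_tsupport hx'.2]
    have hψint : ∫ x in a..b', ψ x = 0 := by
      rw [intervalIntegral.integral_eq_integral_of_support_subset]
      · simp only [hψ]
        rw [integral_sub hφi (h0int.const_mul I), integral_const_mul, h0i, mul_one, sub_self]
      · intro x hx
        by_contra h
        exact hx (hψ0 x fun h' => h (Ioo_subset_Ioc_self h'))
    set η : ℝ → ℝ := fun x => ∫ t in a..x, ψ t with hη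
    have hηd : ∀ x, HasDerivAt η (ψ x) x := fun x =>
      intervalIntegral.integral_hasDerivAt_right (hcont.intervalIntegrable _ _)
        (hcont.stronglyMeasurableAtFilter _ _) hcont.continuousAt
    have hderiv : deriv η = ψ := funext fun x => (hηd x).deriv
    have hηs : ContDiff ℝ ∞ η := by
      rw [contDiff_infty_iff_deriv]
      exact ⟨fun x => (hηd x).differentiableAt, hderiv ▸ hψd⟩
    have hsupp : Function.support η ⊆ Icc a b' := by
      intro x hx
      by_contra h
      apply hx
      rw [mem_Icc, not_and_or, not_le, not_le] at h
      rcases h with h | h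
      · simp only [hη]
        rw [intervalIntegral.integral_symm, intervalIntegral.integral_congr (g := fun _ => 0)]
        · simp
        · intro y hy
          rw [uIcc_of_le h.le] at hy
          exact hψ0 y fun h' => by linarith [hy.2, h'.1]
      · simp only [hη]
        rw [← intervalIntegral.integral_add_adjacent_intervals
          (hcont.intervalIntegrable a b') (hcont.intervalIntegrable b' x), hψint, zero_add,
          intervalIntegral.integral_congr (g := fun _ => 0)]
        · simp
        · intro y hy
          rw [uIcc_of_le h.le] at hy
          exact hψ0 y fun h' => by linarith [hy.1, h'.2]
    have hts : tsupport η ⊆ Icc a b' := closure_minimal hsupp isClosed_Icc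
    have hηc : HasCompactSupport η := isCompact_Icc.of_isClosed_subset (isClosed_tsupport _) hts
    have h1 := H η hηs hηc (hts.trans fun x hx => lt_of_lt_of_le ha hx.1)
    rw [hderiv] at h1
    have h2 : ∀ r, φ r • (h r - c) = (h r * ψ r + I * (h r * φ₀ r)) - c * φ r := by
      intro r
      simp only [hψ, smul_eq_mul]
      ring
    have hi1 := hint φ hφ.continuous hφc hφs
    have hi2 := hint φ₀ h0d.continuous h0c h0s
    have hi3 : Integrable fun r => h r * ψ r := by
      have : (fun r => h r * ψ r) = fun r => h r * φ r - I * (h r * φ₀ r) := by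
        funext r; simp only [hψ]; ring
      rw [this]
      exact hi1.sub (hi2.const_mul I)
    simp_rw [h2]
    have hi4 : Integrable fun r => h r * ψ r + I * (h r * φ₀ r) := hi3.add (hi2.const_mul I)
    rw [integral_sub hi4 (hφi.const_mul c),
      integral_add hi3 (hi2.const_mul I), h1, integral_const_mul, integral_const_mul]
    ring
  have := isOpen_Ioi.ae_eq_zero_of_integral_contDiff_smul_eq_zero
    (hh.sub ((locallyIntegrable_const c).locallyIntegrableOn _)) key
  filter_upwards [this] with r hr hr'
  have := hr hr'
  simp only [Pi.sub_apply] at this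
  linarith

/-- A function with a locally integrable weak derivative on the half-line has an absolutely
continuous representative. -/
theorem exists_ae_eq_primitive_of_weak_deriv {f G : ℝ → ℝ}
    (hf : LocallyIntegrableOn f (Ioi 0)) (hG : LocallyIntegrableOn G (Ioi 0))
    (H : ∀ η : ℝ → ℝ, ContDiff ℝ ∞ η → HasCompactSupport η → tsupport η ⊆ Ioi 0 →
      ∫ r, f r * deriv η r = -∫ r, G r * η r) :
    ∃ c : ℝ, ∀ᵐ r, r ∈ Ioi (0:ℝ) → f r = c + ∫ t in (1:ℝ)..r, G t := by
  set F : ℝ → ℝ := fun r => ∫ t in (1:ℝ)..r, G t with hF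
  have hFc : ContinuousOn F (Ioi 0) := by
    intro x hx
    rw [mem_Ioi] at hx
    -- The interval from `min (x / 2) 1` to `x + 1` has `x` in its interior and contains the base
    -- point `1` of the primitive.
    have hm : 0 < min (x / 2) 1 := by positivity
    have hac := (intervalIntegrable_of_locallyIntegrableOn_Ioi hG hm
      (show 0 < x + 1 by linarith)).absolutelyContinuousOnInterval_intervalIntegral (c := 1)
      (by rw [uIcc_of_le ((min_le_right _ _).trans (by linarith))]
          exact ⟨min_le_right _ _, by linarith⟩)
    have := hac.continuousOn
    rw [uIcc_of_le ((min_le_right _ _).trans (by linarith))] at this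
    exact (this.continuousAt (Icc_mem_nhds ((min_le_left _ _).trans_lt (by linarith))
      (by linarith))).continuousWithinAt
  have hFl : LocallyIntegrableOn F (Ioi 0) := hFc.locallyIntegrableOn measurableSet_Ioi
  obtain ⟨c, hc⟩ := exists_ae_eq_const_of_integral_mul_deriv_eq_zero (hf.sub hFl) (by
    intro η hη hηc hηs
    have hdc : HasCompactSupport (deriv η) := hηc.deriv
    have hds : tsupport (deriv η) ⊆ Ioi 0 := (tsupport_deriv_subset (f := η)).trans hηs
    have hdcont : Continuous (deriv η) := hη.continuous_deriv (by norm_cast)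
    have hint : ∀ k : ℝ → ℝ, LocallyIntegrableOn k (Ioi 0) →
        Integrable fun r => k r * deriv η r := by
      intro k hk
      have h1 := (hk.integrableOn_compact_subset hds hdc).mul_continuousOn
        hdcont.continuousOn hdc
      refine (integrableOn_iff_integrable_of_support_subset ?_).1 h1
      intro x hx
      by_contra hx'
      exact hx (by simp [image_eq_zero_of_notMem_tsupport hx'])
    have e : ∀ r, (f - F) r * deriv η r = f r * deriv η r - F r * deriv η r := fun r => by
      simp only [Pi.sub_apply]; ring
    simp_rw [e]
    rw [integral_sub (hint f hf) (hint F hFl), H η hη hηc hηs,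
      integral_primitive_mul_deriv hG hη hηc hηs, sub_self])
  refine ⟨c, ?_⟩
  filter_upwards [hc] with r hr hr'
  have := hr hr'
  simp only [Pi.sub_apply] at this
  linarith

/-! ### Absolute continuity and increments of `r ^ κ * |F r| ^ p` -/

/-- Post-composition with a locally Lipschitz function preserves absolute continuity. -/
theorem comp_absolutelyContinuousOnInterval {f g : ℝ → ℝ} {a b : ℝ} {K : NNReal}
    (hf : AbsolutelyContinuousOnInterval f a b) (hg : LipschitzOnWith K g (f '' uIcc a b)) :
    AbsolutelyContinuousOnInterval (g ∘ f) a b := by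
  rw [absolutelyContinuousOnInterval_iff] at hf ⊢
  intro ε hε
  obtain ⟨δ, hδ, h⟩ := hf (ε / (K + 1)) (by positivity)
  refine ⟨δ, hδ, fun E hE hlt => ?_⟩
  have h1 := h E hE hlt
  calc ∑ i ∈ Finset.range E.1, dist ((g ∘ f) (E.2 i).1) ((g ∘ f) (E.2 i).2)
      ≤ ∑ i ∈ Finset.range E.1, K * dist (f (E.2 i).1) (f (E.2 i).2) := by
        refine Finset.sum_le_sum fun i hi => ?_
        exact hg.dist_le_mul _ (mem_image_of_mem _ (hE.1 i hi).1) _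
          (mem_image_of_mem _ (hE.1 i hi).2)
    _ = K * ∑ i ∈ Finset.range E.1, dist (f (E.2 i).1) (f (E.2 i).2) := by
        rw [Finset.mul_sum]
    _ ≤ K * (ε / (K + 1)) := by gcongr
    _ < ε := by
        rw [mul_div_assoc', div_lt_iff₀ (by positivity)]
        nlinarith

theorem absolutelyContinuousOnInterval_abs_rpow {f : ℝ → ℝ} {a b p : ℝ} (hp : 1 < p)
    (hf : AbsolutelyContinuousOnInterval f a b) :
    AbsolutelyContinuousOnInterval (fun x => |f x| ^ p) a b := by
  obtain ⟨C, hC⟩ := hf.exists_bound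
  have hC0 : 0 ≤ C := (norm_nonneg _).trans (hC a left_mem_uIcc)
  -- On `[-C, C]`, which contains the range of `f`, the derivative of `|y|^p` has absolute value
  -- `p|y|^(p-1) ≤ p C^(p-1)`.
  refine comp_absolutelyContinuousOnInterval (K := (p * C ^ (p - 1)).toNNReal)
    (g := fun y => |y| ^ p) hf ?_
  have hL : LipschitzOnWith (p * C ^ (p - 1)).toNNReal (fun y : ℝ => |y| ^ p) (Icc (-C) C) := by
    refine (convex_Icc _ _).lipschitzOnWith_of_nnnorm_hasDerivWithin_le
      (fun y _ => (hasDerivAt_abs_rpow y hp).hasDerivWithinAt) fun y hy => ?_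
    rw [← NNReal.coe_le_coe, coe_nnnorm, Real.coe_toNNReal _ (by positivity)]
    have hyC : |y| ≤ C := abs_le.2 hy
    rcases eq_or_ne y 0 with rfl | hy0
    · simp only [mul_zero, norm_zero]; positivity
    rw [norm_mul, norm_mul, Real.norm_of_nonneg (by linarith : 0 ≤ p),
      Real.norm_of_nonneg (by positivity), Real.norm_eq_abs, mul_assoc,
      ← Real.rpow_add_one (abs_pos.2 hy0).ne', show p - 2 + 1 = p - 1 by ring]
    gcongr
  refine hL.mono ?_
  rintro _ ⟨x, hx, rfl⟩
  exact abs_le.1 (hC x hx)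

/-- Bound for the increments of `r ^ κ * |F r| ^ p`, where `F` is a primitive of `G`. -/
theorem enorm_rpow_mul_abs_rpow_sub_le {G : ℝ → ℝ} (hG : LocallyIntegrableOn G (Ioi 0))
    (c κ : ℝ) {p R r s : ℝ} (hp : 1 < p) (hr : r ∈ Ioo 0 R) (hs : s ∈ Ioo 0 R) {F : ℝ → ℝ}
    (hF : ∀ x, F x = c + ∫ t in (1:ℝ)..x, G t) :
    ‖r ^ κ * |F r| ^ p - s ^ κ * |F s| ^ p‖ₑ ≤ ∫⁻ t in Ioo 0 R,
      ENNReal.ofReal (|κ| * (t ^ (κ - 1) * |F t| ^ p) + p * (t ^ κ * (|F t| ^ (p - 1) * |G t|))) := by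
  have hpos : ∀ {x y z : ℝ}, 0 < x → 0 < y → z ∈ uIcc x y → 0 < z := fun hx hy hz =>
    lt_of_lt_of_le (lt_min hx hy) hz.1
  -- The working interval must contain the base point `1` besides `r` and `s`, while staying away
  -- from `0`, where `G` may fail to be integrable.
  have hmin : 0 < min s (min r 1) := lt_min hs.1 (lt_min hr.1 one_pos)
  have hmax : 0 < max s (max r 1) := lt_max_of_lt_left hs.1
  have hGi := intervalIntegrable_of_locallyIntegrableOn_Ioi hG hmin hmax
  have hmm : min s (min r 1) ≤ max s (max r 1) := (min_le_left _ _).trans (le_max_left _ _)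
  have hone : (1:ℝ) ∈ uIcc (min s (min r 1)) (max s (max r 1)) := by
    rw [uIcc_of_le hmm]; simp
  have hsub : uIcc s r ⊆ uIcc (min s (min r 1)) (max s (max r 1)) := by
    rw [uIcc_of_le hmm]
    apply uIcc_subset_Icc <;> simp
  have hFac : AbsolutelyContinuousOnInterval F s r := by
    have h0 := (hGi.absolutelyContinuousOnInterval_intervalIntegral hone).mono hsub
    have h1 : AbsolutelyContinuousOnInterval (fun _ : ℝ => c) s r :=
      (LipschitzWith.const c).lipschitzOnWith.absolutelyContinuousOnInterval
    have h2 : F = (fun _ => c) + fun x => ∫ t in (1:ℝ)..x, G t := funext hF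
    rw [h2]
    exact h1.add h0
  have hpow : AbsolutelyContinuousOnInterval (fun x : ℝ => x ^ κ) s r := by
    refine ContDiffOn.absolutelyContinuousOnInterval fun x hx => ?_
    exact (Real.contDiffAt_rpow_const (Or.inl (hpos hs.1 hr.1 hx).ne')).contDiffWithinAt
  have hω := hpow.mul (absolutelyContinuousOnInterval_abs_rpow hp hFac)
  have hint := hω.integral_deriv_eq_sub
  simp only [Pi.mul_apply] at hint
  rw [← hint]
  have hsubIoo : uIoc s r ⊆ Ioo 0 R := fun x hx =>
    ⟨hpos hs.1 hr.1 (uIoc_subset_uIcc hx), lt_of_le_of_lt hx.2 (max_lt hs.2 hr.2)⟩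
  have hder : ∀ᵐ x, x ∈ uIoc s r →
      deriv ((fun x : ℝ => x ^ κ) * fun x => |F x| ^ p) x
        = κ * x ^ (κ - 1) * |F x| ^ p + x ^ κ * (p * |F x| ^ (p - 2) * F x * G x) := by
    filter_upwards [hGi.ae_hasDerivAt_integral] with x hx hxm
    have hxI := uIoc_subset_uIcc hxm
    have hx0 : 0 < x := hpos hs.1 hr.1 hxI
    have hFd : HasDerivAt F (G x) x := by
      have := (hx (hsub hxI) 1 hone).const_add c
      rwa [← funext hF] at this
    have h1 : HasDerivAt (fun x : ℝ => x ^ κ) (κ * x ^ (κ - 1)) x :=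
      Real.hasDerivAt_rpow_const (Or.inl hx0.ne')
    have h2 : HasDerivAt (fun x => |F x| ^ p) (p * |F x| ^ (p - 2) * F x * G x) x :=
      (hasDerivAt_abs_rpow (F x) hp).comp x hFd
    exact (h1.mul h2).deriv
  calc ‖∫ x in s..r, deriv ((fun x : ℝ => x ^ κ) * fun x => |F x| ^ p) x‖ₑ
      = ‖∫ x in uIoc s r, deriv ((fun x : ℝ => x ^ κ) * fun x => |F x| ^ p) x‖ₑ := by
        rw [← ofReal_norm, ← ofReal_norm, intervalIntegral.norm_intervalIntegral_eq]
    _ ≤ ∫⁻ x in uIoc s r, ‖deriv ((fun x : ℝ => x ^ κ) * fun x => |F x| ^ p) x‖ₑ :=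
        enorm_integral_le_lintegral_enorm _
    _ ≤ ∫⁻ t in uIoc s r, ENNReal.ofReal (|κ| * (t ^ (κ - 1) * |F t| ^ p) +
          p * (t ^ κ * (|F t| ^ (p - 1) * |G t|))) := by
        refine lintegral_mono_ae ((ae_restrict_iff' measurableSet_uIoc).2 ?_)
        filter_upwards [hder] with x hx hxm
        have hx0 : 0 < x := (hsubIoo hxm).1
        rw [hx hxm, ← ofReal_norm, Real.norm_eq_abs]
        refine ENNReal.ofReal_le_ofReal ((abs_add_le _ _).trans (le_of_eq ?_))
        rw [abs_mul, abs_mul, abs_mul, abs_mul, abs_mul, abs_mul,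
          abs_of_pos (Real.rpow_pos_of_pos hx0 _), abs_of_pos (Real.rpow_pos_of_pos hx0 _),
          abs_of_nonneg (show 0 ≤ |F x| ^ p by positivity),
          abs_of_nonneg (show 0 ≤ |F x| ^ (p - 2) by positivity),
          abs_of_pos (show 0 < p by linarith)]
        have : |F x| ^ (p - 2) * |F x| = |F x| ^ (p - 1) := by
          rcases eq_or_ne (F x) 0 with h0 | h0
          · rw [h0, abs_zero, mul_zero, Real.zero_rpow (by linarith)]
          · rw [← Real.rpow_add_one (abs_pos.2 h0).ne']
            congr 1; ring
        rw [← this]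
        ring
    _ ≤ _ := lintegral_mono_set hsubIoo

/-- Weighted pointwise bound for the primitive `F` of `G` by weighted integrals of `F` and `G`. -/
theorem ofReal_rpow_mul_abs_rpow_le {G : ℝ → ℝ} (hG : LocallyIntegrableOn G (Ioi 0))
    (c κ : ℝ) {p R r : ℝ} (hp : 1 < p) (hr : r ∈ Ioo 0 R) {F : ℝ → ℝ}
    (hF : ∀ x, F x = c + ∫ t in (1:ℝ)..x, G t) :
    ENNReal.ofReal (r ^ κ * |F r| ^ p) ≤
      (∫⁻ t in Ioo 0 R, ENNReal.ofReal (t ^ (κ - 1) * |F t| ^ p)) + ∫⁻ t in Ioo 0 R,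
      ENNReal.ofReal (|κ| * (t ^ (κ - 1) * |F t| ^ p) + p * (t ^ κ * (|F t| ^ (p - 1) * |G t|))) := by
  set D := ∫⁻ t in Ioo 0 R,
      ENNReal.ofReal (|κ| * (t ^ (κ - 1) * |F t| ^ p) + p * (t ^ κ * (|F t| ^ (p - 1) * |G t|)))
  have hR : 0 < R := hr.1.trans hr.2
  have hR0 : ENNReal.ofReal R ≠ 0 := by simpa using hR
  -- No boundary value is available at `0` or `R`. The value at `r` is instead compared with the
  -- value at every `s`, using `s^κ ≤ R s^(κ-1)`; integrating over `s ∈ (0, R)` and dividing by `R`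
  -- gives the bound.
  have h1 : ∀ s ∈ Ioo 0 R, ENNReal.ofReal (r ^ κ * |F r| ^ p) ≤
      ENNReal.ofReal R * ENNReal.ofReal (s ^ (κ - 1) * |F s| ^ p) + D := by
    intro s hs
    have h2 := enorm_rpow_mul_abs_rpow_sub_le hG c κ hp hr hs hF
    calc ENNReal.ofReal (r ^ κ * |F r| ^ p)
        ≤ ENNReal.ofReal (s ^ κ * |F s| ^ p + |r ^ κ * |F r| ^ p - s ^ κ * |F s| ^ p|) := by
          refine ENNReal.ofReal_le_ofReal ?_
          linarith [le_abs_self (r ^ κ * |F r| ^ p - s ^ κ * |F s| ^ p)]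
      _ ≤ ENNReal.ofReal (s ^ κ * |F s| ^ p) +
          ENNReal.ofReal |r ^ κ * |F r| ^ p - s ^ κ * |F s| ^ p| := ENNReal.ofReal_add_le
      _ ≤ _ := by
          refine add_le_add ?_ ?_
          · rw [← ENNReal.ofReal_mul hR.le]
            refine ENNReal.ofReal_le_ofReal ?_
            have : s ^ κ = s * s ^ (κ - 1) := by
              rw [mul_comm, ← Real.rpow_add_one hs.1.ne']
              congr 1; ring
            rw [this, mul_assoc]
            have := hs.2.le
            have := hs.1.le
            gcongr
          · rw [← Real.norm_eq_abs, ofReal_norm]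
            exact h2
  have h3 := setLIntegral_mono' (μ := volume) measurableSet_Ioo h1
  rw [setLIntegral_const, Real.volume_Ioo, sub_zero, lintegral_add_right _ measurable_const,
    setLIntegral_const, Real.volume_Ioo, sub_zero, lintegral_const_mul' _ _ ENNReal.ofReal_ne_top,
    mul_comm D, ← mul_add, mul_comm] at h3
  exact (ENNReal.mul_le_mul_iff_right hR0 ENNReal.ofReal_ne_top).1 h3

/-! ### Polar coordinates -/

/-- The measure `r ^ (n - 1) dr` on the half-line. -/
noncomputable def radialMeasure (n : ℕ) : Measure ℝ :=
  (volume.restrict (Ioi 0)).withDensity fun r => ENNReal.ofReal (r ^ (n - 1))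

instance (n : ℕ) : SFinite (radialMeasure n) := by
  unfold radialMeasure; infer_instance

/-- Polar coordinates in an `N`-dimensional space. -/
theorem measurePreserving_polar {E : Type*} [NormedAddCommGroup E] [NormedSpace ℝ E]
    [MeasurableSpace E] [BorelSpace E] [FiniteDimensional ℝ E] [Nontrivial E]
    (μ : Measure E) [μ.IsAddHaarMeasure] :
    MeasurePreserving (fun z : Metric.sphere (0 : E) 1 × ℝ => z.2 • (z.1 : E))
      (μ.toSphere.prod (radialMeasure (Module.finrank ℝ E))) μ := by
  have h1 := (μ.measurePreserving_homeomorphUnitSphereProd).symm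
    (e := (homeomorphUnitSphereProd E).toMeasurableEquiv)
  have h2 : MeasurePreserving (Subtype.val : ({0}ᶜ : Set E) → E) (μ.comap Subtype.val) μ := by
    have := measurePreserving_subtype_coe (μa := μ) (s := ({0}ᶜ : Set E))
      (measurableSet_singleton 0).compl
    rwa [restrict_compl_singleton] at this
  have h3 := h2.comp h1
  have hρ : (Measure.volumeIoiPow (Module.finrank ℝ E - 1)).map Subtype.val
      = radialMeasure (Module.finrank ℝ E) := by
    unfold Measure.volumeIoiPow radialMeasure
    ext s hs
    rw [Measure.map_apply measurable_subtype_coe hs, withDensity_apply _ (measurable_subtype_coe hs),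
      withDensity_apply _ hs, Measure.restrict_restrict hs,
      setLIntegral_subtype measurableSet_Ioi _ (fun r : ℝ => ENNReal.ofReal (r ^ (Module.finrank ℝ E - 1))),
      Subtype.image_preimage_coe, inter_comm]
  have h4 : MeasurePreserving (Prod.map id Subtype.val :
      Metric.sphere (0 : E) 1 × Ioi (0:ℝ) → Metric.sphere (0 : E) 1 × ℝ)
      (μ.toSphere.prod (Measure.volumeIoiPow (Module.finrank ℝ E - 1)))
      (μ.toSphere.prod (radialMeasure (Module.finrank ℝ E))) := by
    have : SFinite ((Measure.volumeIoiPow (Module.finrank ℝ E - 1)).map Subtype.val) := by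
      rw [hρ]; infer_instance
    exact (MeasurePreserving.id μ.toSphere).prod ⟨measurable_subtype_coe, hρ⟩
  have hm : Measurable (fun z : Metric.sphere (0 : E) 1 × ℝ => z.2 • (z.1 : E)) := by fun_prop
  refine ⟨hm, ?_⟩
  rw [← h4.map_eq, Measure.map_map hm h4.measurable]
  convert h3.map_eq using 2
  rfl

theorem polar_comp_norm {N : ℕ} [Nontrivial (Eucl N)] {φ : ℝ → ℝ≥0∞} (hφ : Measurable φ) :
    ∫⁻ x : Eucl N, φ ‖x‖ =
      (volume : Measure (Eucl N)).toSphere univ *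
        ∫⁻ r in Ioi (0:ℝ), ENNReal.ofReal (r ^ (N - 1)) * φ r := by
  have h := measurePreserving_polar (volume : Measure (Eucl N))
  rw [finrank_euclideanSpace_fin] at h
  have hm : Measurable fun x : Eucl N => φ ‖x‖ := hφ.comp measurable_norm
  have hj := hm.comp h.measurable
  rw [Function.comp_def] at hj
  rw [← h.lintegral_comp hm, lintegral_prod_symm' _ hj]
  have h1 : ∀ (r : ℝ) (θ : Metric.sphere (0 : Eucl N) 1), φ ‖r • (θ : Eucl N)‖ = φ |r| := by
    intro r θ
    rw [norm_smul, norm_eq_of_mem_sphere, mul_one, Real.norm_eq_abs]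
  simp_rw [h1, lintegral_const, radialMeasure]
  have hφa : Measurable fun r : ℝ => φ |r| := hφ.comp measurable_norm
  rw [lintegral_mul_const _ hφa, mul_comm,
    lintegral_withDensity_eq_lintegral_mul _ (by fun_prop) hφa]
  congr 1
  refine setLIntegral_congr_fun measurableSet_Ioi fun r hr => ?_
  simp only [Pi.mul_apply]
  rw [abs_of_pos hr]

/-- The polar formula applied to the indicator of a null set of radii gives zero. This transfers
almost-everywhere statements from the half-line to the space. -/
theorem quasiMeasurePreserving_norm {N : ℕ} [Nontrivial (Eucl N)] :
    Measure.QuasiMeasurePreserving (fun x : Eucl N => ‖x‖) volume (volume.restrict (Ioi 0)) := by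
  refine ⟨measurable_norm, ?_⟩
  refine Measure.AbsolutelyContinuous.mk fun s hs h0 => ?_
  rw [Measure.map_apply measurable_norm hs, ← lintegral_indicator_one (measurable_norm hs)]
  have h1 := polar_comp_norm (N := N) (φ := s.indicator 1) (measurable_one.indicator hs)
  have h2 : ∀ x : Eucl N, ((fun x : Eucl N => ‖x‖) ⁻¹' s).indicator (1 : Eucl N → ℝ≥0∞) x
    = s.indicator 1 ‖x‖ := fun x => rfl
  simp_rw [h2, h1]
  have h3 : ∫⁻ r in Ioi (0:ℝ), ENNReal.ofReal (r ^ (N - 1)) * s.indicator 1 r = 0 := by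
    rw [lintegral_eq_zero_iff (by measurability)]
    have : ∀ᵐ r ∂(volume.restrict (Ioi (0:ℝ))), r ∉ s := measure_eq_zero_iff_ae_notMem.1 h0
    filter_upwards [this] with r hr
    simp [hr]
  rw [h3, mul_zero]

/-! ### Spherical means of the radial component of a field -/

/-- The average over the unit sphere of the radial component of a vector field. -/
noncomputable def radialAverage {N : ℕ} (g : Eucl N → Eucl N) (r : ℝ) : ℝ :=
  ((volume : Measure (Eucl N)).toSphere.real univ)⁻¹ *
    ∫ θ, inner ℝ (g (r • (θ : Eucl N))) (θ : Eucl N) ∂(volume : Measure (Eucl N)).toSphere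

theorem toSphere_univ_ne_zero {N : ℕ} [Nontrivial (Eucl N)] :
    (volume : Measure (Eucl N)).toSphere univ ≠ 0 :=
  Measure.measure_univ_ne_zero.2 (Measure.toSphere_ne_zero _)

theorem toSphere_real_univ_pos {N : ℕ} [Nontrivial (Eucl N)] :
    0 < (volume : Measure (Eucl N)).toSphere.real univ := by
  refine ENNReal.toReal_pos toSphere_univ_ne_zero (measure_ne_top _ _)

theorem measurable_radialAverage {N : ℕ} {g : Eucl N → Eucl N} (hg : Measurable g) :
    Measurable (radialAverage g) := by
  unfold radialAverage
  refine Measurable.const_mul ?_ _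
  have : StronglyMeasurable fun z : ℝ × Metric.sphere (0 : Eucl N) 1 =>
      inner ℝ (g (z.1 • (z.2 : Eucl N))) (z.2 : Eucl N) := by
    refine Measurable.stronglyMeasurable ?_
    refine Measurable.inner (hg.comp (by fun_prop)) (by fun_prop)
  exact this.integral_prod_right'.measurable

theorem toSphere_mul_enorm_radialAverage_le {N : ℕ} [Nontrivial (Eucl N)] (g : Eucl N → Eucl N)
    (r : ℝ) :
    (volume : Measure (Eucl N)).toSphere univ * ‖radialAverage g r‖ₑ ≤
      ∫⁻ θ : Metric.sphere (0 : Eucl N) 1, ‖g (r • (θ : Eucl N))‖ₑ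
        ∂(volume : Measure (Eucl N)).toSphere := by
  have hω := toSphere_real_univ_pos (N := N)
  have h1 : (volume : Measure (Eucl N)).toSphere univ =
      ‖(volume : Measure (Eucl N)).toSphere.real univ‖ₑ := by
    rw [Real.enorm_of_nonneg hω.le, Measure.real, ENNReal.ofReal_toReal (measure_ne_top _ _)]
  rw [h1, ← enorm_mul, radialAverage, mul_inv_cancel_left₀ hω.ne']
  refine (enorm_integral_le_lintegral_enorm _).trans (lintegral_mono fun θ => ?_)
  rw [← ofReal_norm, ← ofReal_norm]
  refine ENNReal.ofReal_le_ofReal ((norm_inner_le_norm _ _).trans ?_)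
  rw [norm_eq_of_mem_sphere, mul_one]

/-- Weighted integrals of the radial average are controlled by those of the field. -/
theorem lintegral_radialAverage_le {N : ℕ} [Nontrivial (Eucl N)] {g : Eucl N → Eucl N}
    (hg : Measurable g) {w : ℝ → ℝ≥0∞} (hw : Measurable w) :
    (volume : Measure (Eucl N)).toSphere univ *
      ∫⁻ r in Ioi (0:ℝ), ENNReal.ofReal (r ^ (N - 1)) * (w r * ‖radialAverage g r‖ₑ) ≤
    ∫⁻ x : Eucl N, w ‖x‖ * ‖g x‖ₑ := by
  have h := measurePreserving_polar (volume : Measure (Eucl N))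
  rw [finrank_euclideanSpace_fin] at h
  have hm : Measurable fun x : Eucl N => w ‖x‖ * ‖g x‖ₑ :=
    (hw.comp measurable_norm).mul hg.enorm
  have hj := hm.comp h.measurable
  rw [Function.comp_def] at hj
  rw [← h.lintegral_comp hm, lintegral_prod_symm' _ hj, radialMeasure,
    lintegral_withDensity_eq_lintegral_mul _ (by fun_prop) hj.lintegral_prod_left']
  rw [← lintegral_const_mul' _ _ (measure_ne_top _ _)]
  refine setLIntegral_mono' measurableSet_Ioi fun r hr => ?_
  simp only [Pi.mul_apply]
  rw [mul_left_comm]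
  gcongr
  have h1 : ∀ θ : Metric.sphere (0 : Eucl N) 1, ‖r • (θ : Eucl N)‖ = r := by
    intro θ
    rw [norm_smul, norm_eq_of_mem_sphere, mul_one, Real.norm_of_nonneg (le_of_lt hr)]
  simp_rw [h1]
  have hgr : Measurable fun θ : Metric.sphere (0 : Eucl N) 1 => ‖g (r • (θ : Eucl N))‖ₑ :=
    (hg.comp (by fun_prop : Measurable fun θ : Metric.sphere (0 : Eucl N) 1 =>
      r • (θ : Eucl N))).enorm
  rw [lintegral_const_mul _ hgr, mul_left_comm]
  gcongr
  exact toSphere_mul_enorm_radialAverage_le g r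

/-- A compact subset of the half-line lies in some `(a, b)` with `a > 0`, where the weight `r^(N-1)`
is at least `a^(N-1)` and can be divided out. -/
theorem locallyIntegrableOn_Ioi_of_weighted {N : ℕ} {F : ℝ → ℝ} (hF : Measurable F)
    (h : ∀ b : ℝ, ∫⁻ r in Ioi (0:ℝ),
      ENNReal.ofReal (r ^ (N - 1)) * ((Iio b).indicator 1 r * ‖F r‖ₑ) < ⊤) :
    LocallyIntegrableOn F (Ioi 0) := by
  rw [locallyIntegrableOn_iff isOpen_Ioi.isLocallyClosed]
  intro k hk hkc
  obtain ⟨a, b, ha, -, -, hab⟩ := exists_subset_Ioo_of_isCompact hkc hk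
  refine IntegrableOn.mono_set ?_ hab
  refine ⟨hF.aestronglyMeasurable, ?_⟩
  rw [HasFiniteIntegral]
  have h1 : ∫⁻ r in Ioo a b, ENNReal.ofReal (a ^ (N - 1)) * ‖F r‖ₑ < ⊤ := by
    refine lt_of_le_of_lt ?_ (h b)
    refine le_trans (setLIntegral_mono' measurableSet_Ioo fun r hr => ?_)
      (lintegral_mono_set fun r hr => ha.trans hr.1)
    rw [indicator_of_mem (show r ∈ Iio b from hr.2), Pi.one_apply, one_mul]
    gcongr
    exact hr.1.le
  rw [lintegral_const_mul' _ _ ENNReal.ofReal_ne_top] at h1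
  have ha' : ENNReal.ofReal (a ^ (N - 1)) ≠ 0 := by
    simpa using pow_pos ha _
  exact ENNReal.lt_top_of_mul_ne_top_right h1.ne ha'

theorem lintegral_ball_enorm_lt_top {N : ℕ} {F : Type*} [NormedAddCommGroup F] {k : Eucl N → F}
    (hk : LocallyIntegrable k) (b : ℝ) :
    ∫⁻ x : Eucl N, (Iio b).indicator 1 ‖x‖ * ‖k x‖ₑ < ⊤ := by
  have h1 := (hk.integrableOn_isCompact (isCompact_closedBall (0 : Eucl N) b)).mono_set
    Metric.ball_subset_closedBall
  have h2 := h1.2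
  rw [HasFiniteIntegral, ← lintegral_indicator measurableSet_ball] at h2
  refine lt_of_le_of_lt (lintegral_mono fun x => ?_) h2
  by_cases hx : ‖x‖ < b
  · simp [indicator, hx]
  · simp [indicator, hx]

theorem locallyIntegrableOn_radialAverage {N : ℕ} [Nontrivial (Eucl N)] {g : Eucl N → Eucl N}
    (hg : Measurable g) (hgl : LocallyIntegrable g) :
    LocallyIntegrableOn (radialAverage g) (Ioi 0) := by
  refine locallyIntegrableOn_Ioi_of_weighted (N := N) (measurable_radialAverage hg) fun b => ?_
  have h1 := (lintegral_radialAverage_le hg (measurable_one.indicator measurableSet_Iio)).trans_lt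
    (lintegral_ball_enorm_lt_top hgl b)
  exact ENNReal.lt_top_of_mul_ne_top_right h1.ne toSphere_univ_ne_zero

theorem locallyIntegrableOn_of_radial {N : ℕ} [Nontrivial (Eucl N)] {f : ℝ → ℝ}
    (hf : Measurable f) (hfl : LocallyIntegrable fun x : Eucl N => f ‖x‖) :
    LocallyIntegrableOn f (Ioi 0) := by
  refine locallyIntegrableOn_Ioi_of_weighted (N := N) hf fun b => ?_
  have h1 := lintegral_ball_enorm_lt_top hfl b
  rw [polar_comp_norm (φ := fun r => (Iio b).indicator 1 r * ‖f r‖ₑ)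
    ((measurable_one.indicator measurableSet_Iio).mul hf.enorm)] at h1
  exact ENNReal.lt_top_of_mul_ne_top_right h1.ne toSphere_univ_ne_zero

/-! ### Radial test fields and the weak derivative of the profile -/

variable {N : ℕ}

theorem eventually_comp_norm_eq_zero {ρ : ℝ → ℝ} (hs : tsupport ρ ⊆ Ioi 0) :
    ∀ᶠ x in 𝓝 (0 : Eucl N), ρ ‖x‖ = 0 := by
  have h0 : (0:ℝ) ∉ tsupport ρ := fun h => lt_irrefl (0:ℝ) (hs h)
  have h1 : ∀ᶠ r in 𝓝 (0:ℝ), ρ r = 0 := by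
    filter_upwards [(isClosed_tsupport ρ).isOpen_compl.mem_nhds h0] with r hr
    exact image_eq_zero_of_notMem_tsupport hr
  have h2 : Tendsto (fun x : Eucl N => ‖x‖) (𝓝 0) (𝓝 0) := tendsto_norm_zero
  exact h2.eventually h1

/-- The norm is smooth away from the origin, and `ρ` vanishes near `0`. -/
theorem contDiff_comp_norm {ρ : ℝ → ℝ} (hρ : ContDiff ℝ ∞ ρ) (hs : tsupport ρ ⊆ Ioi 0) :
    ContDiff ℝ ∞ fun x : Eucl N => ρ ‖x‖ := by
  rw [contDiff_iff_contDiffAt]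
  intro x
  rcases eq_or_ne x 0 with rfl | hx
  · exact (contDiffAt_const (c := (0:ℝ))).congr_of_eventuallyEq (eventually_comp_norm_eq_zero hs)
  · exact hρ.contDiffAt.comp x (contDiffAt_norm ℝ hx)

theorem hasCompactSupport_comp_norm {ρ : ℝ → ℝ} (hc : HasCompactSupport ρ) :
    HasCompactSupport fun x : Eucl N => ρ ‖x‖ := by
  obtain ⟨b, hb⟩ := hc.isBounded.subset_closedBall (0:ℝ)
  refine HasCompactSupport.intro (isCompact_closedBall (0 : Eucl N) b) fun x hx => ?_
  refine image_eq_zero_of_notMem_tsupport fun h => hx ?_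
  have := hb h
  simpa using this

/-- Summed over `i`, these terms give the divergence `ρ'(|x|)|x| + Nρ(|x|)` of the field `ρ(|x|)x`.
-/
theorem fderiv_comp_norm_mul_coord {ρ : ℝ → ℝ} (hρ : ContDiff ℝ ∞ ρ) {x : Eucl N} (hx : x ≠ 0)
    (i : Fin N) :
    fderiv ℝ (fun y : Eucl N => ρ ‖y‖ * y i) x (EuclideanSpace.single i 1) =
      deriv ρ ‖x‖ * ‖x‖⁻¹ * x i ^ 2 + ρ ‖x‖ := by
  have hn : HasFDerivAt (fun y : Eucl N => ‖y‖) (‖x‖⁻¹ • innerSL ℝ x) x := by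
    have h1 := (hasStrictFDerivAt_norm_sq x).hasFDerivAt.sqrt (by positivity)
    simp only [Real.sqrt_sq (norm_nonneg _)] at h1
    have hx' := norm_ne_zero_iff.2 hx
    have e : (1 / (2 * ‖x‖)) • (2 • innerSL ℝ x) = ‖x‖⁻¹ • innerSL ℝ x := by
      ext y
      simp
      field_simp
    rw [← e]
    exact h1
  have h2 : HasFDerivAt (fun y : Eucl N => ρ ‖y‖) (deriv ρ ‖x‖ • (‖x‖⁻¹ • innerSL ℝ x)) x :=
    ((hρ.differentiable (by simp)) ‖x‖).hasDerivAt.comp_hasFDerivAt x hn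
  have h3 : HasFDerivAt (fun y : Eucl N => y i) (EuclideanSpace.proj (𝕜 := ℝ) i) x :=
    (EuclideanSpace.proj (𝕜 := ℝ) i).hasFDerivAt
  have h4 : HasFDerivAt (fun y : Eucl N => ρ ‖y‖ * y i) _ x := h2.mul h3
  have h5 : inner ℝ x (EuclideanSpace.single i (1:ℝ)) = x i := by
    rw [EuclideanSpace.inner_single_right]
    simp
  rw [h4.fderiv]
  simp [h5]
  ring

theorem integrable_coord_mul {g : Eucl N → Eucl N} (hg : LocallyIntegrable g) {ρ : ℝ → ℝ}
    (hρ : ContDiff ℝ ∞ ρ) (hc : HasCompactSupport ρ) (i : Fin N) :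
    Integrable fun x : Eucl N => g x i * (ρ ‖x‖ * x i) := by
  have hgi : LocallyIntegrable fun x => g x i := fun x => by
    obtain ⟨s, hs, h⟩ := hg x
    exact ⟨s, hs, (EuclideanSpace.proj (𝕜 := ℝ) i).integrable_comp h⟩
  have hd : Continuous fun x : Eucl N => ρ ‖x‖ * x i := by
    have := hρ.continuous
    fun_prop
  exact hgi.integrable_smul_right_of_hasCompactSupport hd (hasCompactSupport_comp_norm hc).mul_right

theorem inner_mul_comp_norm_eq_sum (g : Eucl N → Eucl N) (ρ : ℝ → ℝ) (x : Eucl N) :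
    inner ℝ (g x) x * ρ ‖x‖ = ∑ i, g x i * (ρ ‖x‖ * x i) := by
  rw [PiLp.inner_apply, Finset.sum_mul]
  refine Finset.sum_congr rfl fun i _ => ?_
  simp
  ring

/-- Integral of a function times the divergence of a radial field. -/
theorem integral_mul_divergence_radial {u : Eucl N → ℝ} {g : Eucl N → Eucl N}
    (hug : HasWeakGradient u g) {ρ : ℝ → ℝ} (hρ : ContDiff ℝ ∞ ρ) (hc : HasCompactSupport ρ)
    (hs : tsupport ρ ⊆ Ioi 0) :
    ∫ x, u x * (deriv ρ ‖x‖ * ‖x‖ + N * ρ ‖x‖) = -∫ x, inner ℝ (g x) x * ρ ‖x‖ := by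
  have hd : ∀ i : Fin N, ContDiff ℝ ∞ fun x : Eucl N => ρ ‖x‖ * x i := fun i =>
    (contDiff_comp_norm hρ hs).mul (EuclideanSpace.proj (𝕜 := ℝ) i).contDiff
  have hcs : ∀ i : Fin N, HasCompactSupport fun x : Eucl N => ρ ‖x‖ * x i := fun i =>
    (hasCompactSupport_comp_norm hc).mul_right
  have hi1 : ∀ i : Fin N, Integrable fun x : Eucl N =>
      u x * fderiv ℝ (fun y : Eucl N => ρ ‖y‖ * y i) x (EuclideanSpace.single i 1) := by
    intro i
    have hcont : Continuous fun x : Eucl N =>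
        fderiv ℝ (fun y : Eucl N => ρ ‖y‖ * y i) x (EuclideanSpace.single i 1) :=
      ((hd i).continuous_fderiv (by simp)).clm_apply continuous_const
    exact hug.locallyIntegrable.integrable_smul_right_of_hasCompactSupport hcont
      ((hcs i).fderiv_apply ℝ _)
  have hi2 := integrable_coord_mul hug.locallyIntegrable_gradient hρ hc
  have h1 : ∀ x : Eucl N, u x * (deriv ρ ‖x‖ * ‖x‖ + N * ρ ‖x‖) =
      ∑ i, u x * fderiv ℝ (fun y : Eucl N => ρ ‖y‖ * y i) x (EuclideanSpace.single i 1) := by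
    intro x
    rw [← Finset.mul_sum]
    congr 1
    rcases eq_or_ne x 0 with rfl | hx
    · have h0 : ρ 0 = 0 := image_eq_zero_of_notMem_tsupport fun h => lt_irrefl (0:ℝ) (hs h)
      have h2 : ∀ i : Fin N, fderiv ℝ (fun y : Eucl N => ρ ‖y‖ * y i) 0 = 0 := by
        intro i
        have : (fun y : Eucl N => ρ ‖y‖ * y i) =ᶠ[𝓝 0] fun _ => 0 := by
          filter_upwards [eventually_comp_norm_eq_zero (N := N) hs] with y hy
          rw [hy, zero_mul]
        rw [this.fderiv_eq]
        simp
      simp [h0, h2]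
    · simp_rw [fderiv_comp_norm_mul_coord hρ hx]
      rw [Finset.sum_add_distrib, ← Finset.mul_sum, Finset.sum_const, Finset.card_univ,
        Fintype.card_fin, nsmul_eq_mul, ← EuclideanSpace.real_norm_sq_eq]
      have := norm_ne_zero_iff.2 hx
      field_simp
  simp_rw [h1, inner_mul_comp_norm_eq_sum]
  rw [integral_finsetSum _ fun i _ => hi1 i, integral_finsetSum _ fun i _ => hi2 i,
    ← Finset.sum_neg_distrib]
  exact Finset.sum_congr rfl fun i _ => hug.integral_eq _ (hd i) (hcs i) i

/-- The radial profile of a radial function with weak gradient `g` has the weak derivative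
`radialAverage g`. -/
theorem integral_mul_deriv_eq_neg_integral_radialAverage [Nontrivial (Eucl N)]
    {f : ℝ → ℝ} {g : Eucl N → Eucl N}
    (hug : HasWeakGradient (fun x : Eucl N => f ‖x‖) g) (hg : Measurable g)
    {η : ℝ → ℝ} (hη : ContDiff ℝ ∞ η) (hc : HasCompactSupport η)
    (hs : tsupport η ⊆ Ioi 0) :
    ∫ r, f r * deriv η r = -∫ r, radialAverage g r * η r := by
  have hN : 0 < N := by
    rcases Nat.eq_zero_or_pos N with rfl | h
    · exact absurd ‹Nontrivial (Eucl 0)› (not_nontrivial _)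
    · exact h
  have hη0 : ∀ r : ℝ, r ∉ Ioi (0:ℝ) → η r = 0 := fun r hr =>
    image_eq_zero_of_notMem_tsupport fun h => hr (hs h)
  have hdη0 : ∀ r : ℝ, r ∉ Ioi (0:ℝ) → deriv η r = 0 := fun r hr =>
    image_eq_zero_of_notMem_tsupport fun h => hr (hs (tsupport_deriv_subset h))
  -- With this choice `rρ' + Nρ = r^(1-N) η'`, so the Jacobian `r^(N-1)` cancels. It cancels on the
  -- gradient side too, where the field `ρ(|x|)x` has radial component `r^(1-N) η`.
  set ρ : ℝ → ℝ := fun r => η r * (r ^ N)⁻¹ with hρ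
  have hρts : tsupport ρ ⊆ tsupport η := closure_mono fun r hr h => hr (by simp [hρ, h])
  have hρs : tsupport ρ ⊆ Ioi 0 := hρts.trans hs
  have hρc : HasCompactSupport ρ := hc.of_isClosed_subset (isClosed_tsupport _) hρts
  have hρd : ContDiff ℝ ∞ ρ := by
    rw [contDiff_iff_contDiffAt]
    intro r
    by_cases hr : r ∈ tsupport η
    · exact hη.contDiffAt.mul ((contDiff_id.pow N).contDiffAt.inv (pow_ne_zero _ (ne_of_gt (hs hr))))
    · refine (contDiffAt_const (c := (0:ℝ))).congr_of_eventuallyEq ?_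
      filter_upwards [(isClosed_tsupport η).isOpen_compl.mem_nhds hr] with t ht
      simp [hρ, image_eq_zero_of_notMem_tsupport ht]
  have hdiv : ∀ r ∈ Ioi (0:ℝ), r ^ (N - 1) * (f r * (deriv ρ r * r + N * ρ r)) = f r * deriv η r := by
    intro r hr
    rw [mem_Ioi] at hr
    have h1 : HasDerivAt ρ (deriv η r * (r ^ N)⁻¹ + η r * (-(N * r ^ (N - 1)) / (r ^ N) ^ 2)) r :=
      ((hη.differentiable (by simp)) r).hasDerivAt.mul ((hasDerivAt_pow N r).inv (by positivity))
    rw [h1.deriv, hρ]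
    obtain ⟨m, rfl⟩ := Nat.exists_eq_add_of_le' hN
    simp only [Nat.add_sub_cancel]
    have : r ≠ 0 := hr.ne'
    field_simp
    ring
  have key := integral_mul_divergence_radial hug hρd hρc hρs
  have hω := toSphere_real_univ_pos (N := N)
  have hL : ∫ x : Eucl N, f ‖x‖ * (deriv ρ ‖x‖ * ‖x‖ + N * ρ ‖x‖) =
      (volume : Measure (Eucl N)).toSphere.real univ * ∫ r, f r * deriv η r := by
    rw [integral_fun_norm_addHaar volume (fun r => f r * (deriv ρ r * r + N * ρ r)),
      Measure.toSphere_real_apply_univ, finrank_euclideanSpace_fin, nsmul_eq_mul, smul_eq_mul,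
      mul_assoc]
    congr 2
    rw [← setIntegral_eq_integral_of_forall_compl_eq_zero (s := Ioi (0:ℝ))
      (f := fun r => f r * deriv η r) (fun r hr => by rw [hdη0 r hr, mul_zero])]
    exact setIntegral_congr_fun measurableSet_Ioi fun r hr => hdiv r hr
  have hpol := measurePreserving_polar (volume : Measure (Eucl N))
  rw [finrank_euclideanSpace_fin] at hpol
  have hR : ∫ x : Eucl N, inner ℝ (g x) x * ρ ‖x‖ =
      (volume : Measure (Eucl N)).toSphere.real univ * ∫ r, radialAverage g r * η r := by
    have hm : Measurable fun x : Eucl N => inner ℝ (g x) x * ρ ‖x‖ :=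
      (hg.inner measurable_id).mul (hρd.continuous.measurable.comp measurable_norm)
    have hint : Integrable fun x : Eucl N => inner ℝ (g x) x * ρ ‖x‖ := by
      simp_rw [inner_mul_comp_norm_eq_sum]
      exact integrable_finsetSum _ fun i _ =>
        integrable_coord_mul hug.locallyIntegrable_gradient hρd hρc i
    have hint' := (hpol.integrable_comp hm.aestronglyMeasurable).2 hint
    rw [Function.comp_def] at hint'
    have e1 : ∫ x : Eucl N, inner ℝ (g x) x * ρ ‖x‖ =
        ∫ z, inner ℝ (g (z.2 • (z.1 : Eucl N))) (z.2 • (z.1 : Eucl N)) * ρ ‖z.2 • (z.1 : Eucl N)‖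
          ∂((volume : Measure (Eucl N)).toSphere.prod (radialMeasure N)) := by
      conv_lhs => rw [← hpol.map_eq]
      exact integral_map hpol.aemeasurable hm.aestronglyMeasurable
    rw [e1, integral_prod_symm _ hint', radialMeasure,
      integral_withDensity_eq_integral_toReal_smul (by fun_prop) (by simp),
      ← setIntegral_eq_integral_of_forall_compl_eq_zero (s := Ioi (0:ℝ))
        (f := fun r => radialAverage g r * η r) (fun r hr => by rw [hη0 r hr, mul_zero]),
      ← integral_const_mul]
    refine setIntegral_congr_fun measurableSet_Ioi fun r hr => ?_
    rw [mem_Ioi] at hr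
    have h1 : ∀ θ : Metric.sphere (0 : Eucl N) 1, ‖r • (θ : Eucl N)‖ = r := by
      intro θ
      rw [norm_smul, norm_eq_of_mem_sphere, mul_one, Real.norm_of_nonneg hr.le]
    simp_rw [h1, real_inner_smul_right]
    rw [integral_mul_const, integral_const_mul, ENNReal.toReal_ofReal (by positivity), hρ,
      radialAverage, smul_eq_mul]
    obtain ⟨m, rfl⟩ := Nat.exists_eq_add_of_le' hN
    simp only [Nat.add_sub_cancel]
    have : r ≠ 0 := hr.ne'
    field_simp
    ring
  rw [hL, hR, ← mul_neg] at key
  exact mul_left_cancel₀ hω.ne' key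

/-! ### The pointwise bound for radial functions -/

/-- A crude Young inequality: both bases are at most `max a b`, and the exponents add up to `1`. It
needs no finiteness. -/
theorem rpow_mul_rpow_le_add {s t : ℝ} (hs : 0 ≤ s) (ht : 0 ≤ t) (hst : s + t = 1) (a b : ℝ≥0∞) :
    a ^ s * b ^ t ≤ a + b := by
  calc a ^ s * b ^ t ≤ (max a b) ^ s * (max a b) ^ t := by
        gcongr
        · exact le_max_left _ _
        · exact le_max_right _ _
    _ = max a b := by rw [← ENNReal.rpow_add_of_nonneg _ _ hs ht, hst, ENNReal.rpow_one]
    _ ≤ a + b := max_le le_self_add le_add_self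

/-- Allows passing to an exact function of `|x|` and to a measurable gradient, as the polar formulas
require. -/
theorem HasWeakGradient.congr_ae {u v : Eucl N → ℝ} {g k : Eucl N → Eucl N}
    (h : HasWeakGradient u g) (huv : u =ᵐ[volume] v) (hgk : g =ᵐ[volume] k) :
    HasWeakGradient v k where
  locallyIntegrable := h.locallyIntegrable.congr huv
  locallyIntegrable_gradient := h.locallyIntegrable_gradient.congr hgk
  integral_eq φ hφ hc i := by
    have h1 : ∫ x, v x * fderiv ℝ φ x (EuclideanSpace.single i 1) =
        ∫ x, u x * fderiv ℝ φ x (EuclideanSpace.single i 1) :=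
      integral_congr_ae (by filter_upwards [huv] with x hx; rw [hx])
    have h2 : ∫ x, k x i * φ x = ∫ x, g x i * φ x :=
      integral_congr_ae (by filter_upwards [hgk] with x hx; rw [hx])
    rw [h1, h2, h.integral_eq φ hφ hc i]

theorem ae_of_ae_norm [Nontrivial (Eucl N)] {Q : ℝ → Prop}
    (h : ∀ᵐ r ∂(volume.restrict (Ioi (0:ℝ))), Q r) : ∀ᵐ x : Eucl N, Q ‖x‖ :=
  quasiMeasurePreserving_norm.ae h

/-- Pointwise bound for a radial function with a weak gradient, in terms of its gradient and of
its norm with the weight `|x| ^ (-γ)`. -/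
theorem exists_radial_pointwise_bound [Nontrivial (Eucl N)] {p γ R : ℝ} (hp : 1 < p) (hγ : p ≤ γ)
    (hR : 0 < R) :
    ∃ C : ℝ≥0∞, C ≠ ⊤ ∧ ∀ (f : ℝ → ℝ) (g : Eucl N → Eucl N), Measurable f → Measurable g →
      HasWeakGradient (fun x : Eucl N => f ‖x‖) g → ∀ᵐ x : Eucl N, ‖x‖ < R →
      ENNReal.ofReal (‖x‖ ^ ((N:ℝ) - 1 - γ * (p - 1) / p)) * ‖f ‖x‖‖ₑ ^ p ≤
        C * ∫⁻ x in Metric.ball (0 : Eucl N) R,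
          (‖g x‖ₑ ^ p + ENNReal.ofReal (‖x‖ ^ (-γ)) * ‖f ‖x‖‖ₑ ^ p) := by
  have hp0 : 0 < p := by linarith
  have hN : 0 < N := by
    rcases Nat.eq_zero_or_pos N with rfl | h
    · exact absurd ‹Nontrivial (Eucl 0)› (not_nontrivial _)
    · exact h
  have hN1 : ((N - 1 : ℕ) : ℝ) = (N:ℝ) - 1 := by
    rw [Nat.cast_sub hN, Nat.cast_one]
  -- This `κ` makes `r^κ = r^(N-1) (r^(-γ))^((p-1)/p)`, the weight for which `|f|^(p-1)|G|` is
  -- controlled by Young's inequality. Moreover `r^(κ-1) = r^(γ/p-1) r^(N-1) r^(-γ)`, and `γ ≥ p`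
  -- bounds the first factor by `c₁` on `(0, R)`.
  set κ : ℝ := (N:ℝ) - 1 - γ * (p - 1) / p with hκ
  set σ := (volume : Measure (Eucl N)).toSphere univ
  have hσ0 : σ ≠ 0 := toSphere_univ_ne_zero
  have hσt : σ ≠ ⊤ := measure_ne_top _ _
  set c₁ := ENNReal.ofReal (R ^ (γ / p - 1))
  refine ⟨σ⁻¹ * c₁ + (ENNReal.ofReal |κ| * (σ⁻¹ * c₁) + ENNReal.ofReal p * σ⁻¹),
    by finiteness, fun f g hf hg hfg => ?_⟩
  obtain ⟨c, hc⟩ := exists_ae_eq_primitive_of_weak_deriv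
    (locallyIntegrableOn_of_radial hf hfg.locallyIntegrable)
    (locallyIntegrableOn_radialAverage hg hfg.locallyIntegrable_gradient)
    (fun η hη hηc hηs => integral_mul_deriv_eq_neg_integral_radialAverage hfg hg hη hηc hηs)
  set G := radialAverage g with hG
  have hGm : Measurable G := measurable_radialAverage hg
  set F : ℝ → ℝ := fun r => c + ∫ t in (1:ℝ)..r, G t with hF
  have hcR : ∀ᵐ r ∂(volume.restrict (Ioo 0 R)), f r = F r := by
    rw [ae_restrict_iff' measurableSet_Ioo]
    filter_upwards [hc] with r hr hr' using hr hr'.1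
  have hc0 : ∀ᵐ r ∂(volume.restrict (Ioi (0:ℝ))), 0 < r ∧ f r = F r := by
    rw [ae_restrict_iff' measurableSet_Ioi]
    filter_upwards [hc] with r hr hr' using ⟨hr', hr hr'⟩
  set J := ∫⁻ x in Metric.ball (0 : Eucl N) R,
          (‖g x‖ₑ ^ p + ENNReal.ofReal (‖x‖ ^ (-γ)) * ‖f ‖x‖‖ₑ ^ p) with hJ
  have hJ' : J = ∫⁻ x : Eucl N, (Metric.ball (0 : Eucl N) R).indicator (fun x =>
      ‖g x‖ₑ ^ p + ENNReal.ofReal (‖x‖ ^ (-γ)) * ‖f ‖x‖‖ₑ ^ p) x := by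
    rw [hJ, lintegral_indicator measurableSet_ball]
  have hen : ∀ (y s : ℝ), 0 ≤ s → ENNReal.ofReal (|y| ^ s) = ‖y‖ₑ ^ s := by
    intro y s hs
    rw [← ofReal_norm, Real.norm_eq_abs, ENNReal.ofReal_rpow_of_nonneg (abs_nonneg _) hs]
  set A := ∫⁻ t in Ioo 0 R, ENNReal.ofReal (t ^ (κ - 1) * |f t| ^ p) with hA
  set B := ∫⁻ t in Ioo 0 R, ENNReal.ofReal (t ^ κ * (|f t| ^ (p - 1) * |G t|)) with hB
  have hAJ : A ≤ σ⁻¹ * c₁ * J := by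
    set φ : ℝ → ℝ≥0∞ := fun t => (Iio R).indicator 1 t * (ENNReal.ofReal (t ^ (-γ)) * ‖f t‖ₑ ^ p)
      with hφ
    have hφm : Measurable φ := by
      refine (measurable_one.indicator measurableSet_Iio).mul (Measurable.mul ?_ ?_)
      · fun_prop
      · exact hf.enorm.pow_const _
    have h1 : A ≤ c₁ * ∫⁻ t in Ioi (0:ℝ), ENNReal.ofReal (t ^ (N - 1)) * φ t := by
      rw [← lintegral_const_mul' _ _ ENNReal.ofReal_ne_top]
      refine le_trans (setLIntegral_mono' measurableSet_Ioo fun t ht => ?_)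
        (lintegral_mono_set fun t ht => ht.1)
      simp only [hφ]
      rw [indicator_of_mem (show t ∈ Iio R from ht.2), Pi.one_apply, one_mul, ← hen _ _ hp0.le,
        ← ENNReal.ofReal_mul (by have := ht.1.le; positivity),
        ← ENNReal.ofReal_mul (by have := ht.1.le; positivity),
        ← ENNReal.ofReal_mul (by positivity), ← Real.rpow_natCast, hN1, ← mul_assoc,
        ← mul_assoc]
      refine ENNReal.ofReal_le_ofReal ?_
      gcongr
      have e : κ - 1 = (γ / p - 1) + ((N:ℝ) - 1) + -γ := by
        rw [hκ]; field_simp; ring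
      rw [e, Real.rpow_add ht.1, Real.rpow_add ht.1]
      have := ht.1
      gcongr
      · rw [sub_nonneg, le_div_iff₀ hp0]; linarith
      · exact ht.2.le
    have h2 : σ * ∫⁻ t in Ioi (0:ℝ), ENNReal.ofReal (t ^ (N - 1)) * φ t ≤ J := by
      rw [← polar_comp_norm hφm, hJ']
      refine lintegral_mono fun x => ?_
      by_cases hx : ‖x‖ < R
      · simp [hφ, indicator, hx]
      · simp [hφ, indicator, hx]
    calc A ≤ c₁ * ∫⁻ t in Ioi (0:ℝ), ENNReal.ofReal (t ^ (N - 1)) * φ t := h1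
      _ = σ⁻¹ * c₁ * (σ * ∫⁻ t in Ioi (0:ℝ), ENNReal.ofReal (t ^ (N - 1)) * φ t) := by
          rw [mul_comm σ⁻¹, mul_assoc, ENNReal.inv_mul_cancel_left hσ0 hσt]
      _ ≤ _ := by gcongr
  have hBJ : B ≤ σ⁻¹ * J := by
    set w : ℝ → ℝ≥0∞ := fun t => (Iio R).indicator 1 t *
      (ENNReal.ofReal (t ^ (-γ * ((p - 1) / p))) * ‖f t‖ₑ ^ (p - 1)) with hw
    have hwm : Measurable w := by
      refine (measurable_one.indicator measurableSet_Iio).mul (Measurable.mul ?_ ?_)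
      · fun_prop
      · exact hf.enorm.pow_const _
    have h1 : B ≤ ∫⁻ t in Ioi (0:ℝ), ENNReal.ofReal (t ^ (N - 1)) * (w t * ‖G t‖ₑ) := by
      refine le_trans (setLIntegral_mono' measurableSet_Ioo fun t ht => ?_)
        (lintegral_mono_set fun t ht => ht.1)
      simp only [hw]
      have e : κ = ((N:ℝ) - 1) + -γ * ((p - 1) / p) := by
        rw [hκ]; field_simp; ring
      rw [indicator_of_mem (show t ∈ Iio R from ht.2), Pi.one_apply, one_mul,
        ← hen _ _ (by linarith : 0 ≤ p - 1), ← ofReal_norm, Real.norm_eq_abs,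
        ← ENNReal.ofReal_mul (by have := ht.1.le; positivity),
        ← ENNReal.ofReal_mul (by have := ht.1.le; positivity),
        ← ENNReal.ofReal_mul (by have := ht.1.le; positivity), ← Real.rpow_natCast, hN1,
        e, Real.rpow_add ht.1]
      refine ENNReal.ofReal_le_ofReal (le_of_eq ?_)
      ring
    have h2 := lintegral_radialAverage_le hg hwm
    have h3 : ∫⁻ x : Eucl N, w ‖x‖ * ‖g x‖ₑ ≤ J := by
      rw [hJ']
      refine lintegral_mono fun x => ?_
      by_cases hx : ‖x‖ < R
      · rw [indicator_of_mem (by simpa using hx)]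
        simp only [hw]
        rw [indicator_of_mem (show ‖x‖ ∈ Iio R from hx), Pi.one_apply, one_mul, add_comm]
        have h4 := rpow_mul_rpow_le_add (s := (p - 1) / p) (t := 1 / p)
          (by apply div_nonneg <;> linarith) (by positivity) (by field_simp; ring)
          (ENNReal.ofReal (‖x‖ ^ (-γ)) * ‖f ‖x‖‖ₑ ^ p) (‖g x‖ₑ ^ p)
        refine le_trans (le_of_eq ?_) h4
        rw [ENNReal.mul_rpow_of_nonneg _ _ (by apply div_nonneg <;> linarith),
          ENNReal.ofReal_rpow_of_nonneg (by positivity) (by apply div_nonneg <;> linarith),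
          ← Real.rpow_mul (norm_nonneg _), ← ENNReal.rpow_mul, ← ENNReal.rpow_mul,
          mul_div_cancel₀ _ hp0.ne', mul_one_div_cancel hp0.ne', ENNReal.rpow_one]
      · simp [hw, indicator, hx]
    calc B ≤ ∫⁻ t in Ioi (0:ℝ), ENNReal.ofReal (t ^ (N - 1)) * (w t * ‖G t‖ₑ) := h1
      _ = σ⁻¹ * (σ * ∫⁻ t in Ioi (0:ℝ), ENNReal.ofReal (t ^ (N - 1)) * (w t * ‖G t‖ₑ)) := by
          rw [ENNReal.inv_mul_cancel_left hσ0 hσt]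
      _ ≤ σ⁻¹ * J := by gcongr; exact h2.trans h3
  have hmain : ∀ r ∈ Ioo 0 R, ENNReal.ofReal (r ^ κ * |F r| ^ p) ≤
      A + (ENNReal.ofReal |κ| * A + ENNReal.ofReal p * B) := by
    intro r hr
    have h1 := ofReal_rpow_mul_abs_rpow_le
      (locallyIntegrableOn_radialAverage hg hfg.locallyIntegrable_gradient) c κ hp hr
      (F := F) (fun x => rfl)
    refine h1.trans (add_le_add (le_of_eq ?_) ?_)
    · refine lintegral_congr_ae ?_
      filter_upwards [hcR] with t ht
      rw [ht]
    · rw [← lintegral_const_mul' _ _ ENNReal.ofReal_ne_top,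
        ← lintegral_const_mul' _ _ ENNReal.ofReal_ne_top, ← lintegral_add_left (by fun_prop)]
      refine lintegral_mono_ae ?_
      filter_upwards [hcR] with t ht
      rw [← ht, ← ENNReal.ofReal_mul (abs_nonneg _), ← ENNReal.ofReal_mul hp0.le]
      exact ENNReal.ofReal_add_le
  filter_upwards [ae_of_ae_norm hc0] with x hx hxR
  rw [← hen _ _ hp0.le, ← ENNReal.ofReal_mul (by positivity), hx.2]
  refine (hmain _ ⟨hx.1, hxR⟩).trans ?_
  calc A + (ENNReal.ofReal |κ| * A + ENNReal.ofReal p * B)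
      ≤ σ⁻¹ * c₁ * J + (ENNReal.ofReal |κ| * (σ⁻¹ * c₁ * J) + ENNReal.ofReal p * (σ⁻¹ * J)) := by
        gcongr
    _ = _ := by ring

theorem lintegral_eq_one_of_wNorm_eq_one {p : ℝ} (hp : 0 < p) {V : ℝ → ℝ≥0∞} {u : Eucl N → ℝ}
    (hu : wNorm p V u = 1) :
    ∫⁻ x, (‖weakGradient u x‖ₑ ^ p + V ‖x‖ * ‖u x‖ₑ ^ p) = 1 := by
  unfold wNorm at hu
  have := congrArg (· ^ p) hu
  simpa [← ENNReal.rpow_mul, hp.ne'] using this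

theorem hasWeakGradient_weakGradient {u : Eucl N → ℝ} (h : ∃ g, HasWeakGradient u g) :
    HasWeakGradient u (weakGradient u) := by
  unfold weakGradient
  rw [dif_pos h]
  exact h.choose_spec

/-- Uniform pointwise bound for the radial functions of the unit sphere of `W`. -/
theorem exists_pointwise_bound_Wr [Nontrivial (Eucl N)] {p γ R : ℝ} (hp : 1 < p) (hγ : p ≤ γ)
    (hR : 0 < R) {V : ℝ → ℝ≥0∞} {D : ℝ≥0∞} (hD : D ≠ ⊤)
    (hV : ∀ᵐ x : Eucl N, ‖x‖ < R → ENNReal.ofReal (‖x‖ ^ (-γ)) ≤ D * V ‖x‖) :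
    ∃ C : ℝ≥0∞, C ≠ ⊤ ∧ ∀ u ∈ Wr N p V, wNorm p V u = 1 → ∀ᵐ x : Eucl N, ‖x‖ < R →
      ENNReal.ofReal (‖x‖ ^ ((N:ℝ) - 1 - γ * (p - 1) / p)) * ‖u x‖ₑ ^ p ≤ C := by
  obtain ⟨C, hC, h⟩ := exists_radial_pointwise_bound (N := N) hp hγ hR
  -- Replacing `|x|^(-γ)` by `D V` bounds the integrand by `1 + D` times that of the norm, whose
  -- integral is `1`.
  refine ⟨C * (1 + D), by finiteness, fun u hu hun => ?_⟩
  obtain ⟨f, hf, huf⟩ := hu.2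
  have hw := hasWeakGradient_weakGradient hu.1.1.2.1
  have hgm := hw.locallyIntegrable_gradient.aestronglyMeasurable
  have hmk := hgm.ae_eq_mk
  filter_upwards [h f _ hf hgm.stronglyMeasurable_mk.measurable (hw.congr_ae huf hmk), huf]
    with x hx hxu hxR
  rw [hxu]
  refine (hx hxR).trans ?_
  gcongr
  have h1 := lintegral_eq_one_of_wNorm_eq_one (by linarith) hun
  calc ∫⁻ x in Metric.ball (0 : Eucl N) R,
          (‖hgm.mk _ x‖ₑ ^ p + ENNReal.ofReal (‖x‖ ^ (-γ)) * ‖f ‖x‖‖ₑ ^ p)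
      ≤ ∫⁻ x in Metric.ball (0 : Eucl N) R,
          (1 + D) * (‖weakGradient u x‖ₑ ^ p + V ‖x‖ * ‖u x‖ₑ ^ p) := by
        refine lintegral_mono_ae ((ae_restrict_iff' measurableSet_ball).2 ?_)
        filter_upwards [hmk, huf, hV] with y hy hyu hyV hyR
        rw [← hy, ← hyu]
        have h2 := hyV (by simpa using hyR)
        calc ‖weakGradient u y‖ₑ ^ p + ENNReal.ofReal (‖y‖ ^ (-γ)) * ‖u y‖ₑ ^ p
            ≤ 1 * ‖weakGradient u y‖ₑ ^ p + D * V ‖y‖ * ‖u y‖ₑ ^ p := by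
              rw [one_mul]; gcongr
          _ ≤ (1 + D) * ‖weakGradient u y‖ₑ ^ p + (1 + D) * V ‖y‖ * ‖u y‖ₑ ^ p := by
              gcongr
              · exact le_self_add
              · exact le_add_self
          _ = _ := by ring
    _ ≤ ∫⁻ x, (1 + D) * (‖weakGradient u x‖ₑ ^ p + V ‖x‖ * ‖u x‖ₑ ^ p) :=
        setLIntegral_le_lintegral _ _
    _ = 1 + D := by rw [lintegral_const_mul' _ _ (by finiteness), h1, mul_one]

/-! ### The exponent region -/

/-- Membership in `regionA` in terms of two linear inequalities. -/
theorem inequalities_of_mem_regionA {p α β γ q : ℝ} (hp : 1 < p) (hpN : p < N)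
    (h : (α, q) ∈ regionA N p β γ) :
    1 < q ∧ p * β < q ∧ q * (N - γ) < p * (α - γ * β + N) ∧
      q * (p * (N - 1) - γ * (p - 1)) < p * (p * α + (1 - p * β) * γ + p * (N - 1)) := by
  have hp1 : 0 < p - 1 := by linarith
  -- Equivalent to `p < N`. It fixes the signs of both denominators in each case, hence whether
  -- clearing them reverses the inequality.
  have hgap : (N:ℝ) < p / (p - 1) * (N - 1) := by
    rw [div_mul_eq_mul_div, lt_div_iff₀ hp1]
    nlinarith
  have hden : ∀ {c : ℝ}, c < p / (p - 1) * (N - 1) ↔ 0 < p * (N - 1) - c * (p - 1) := by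
    intro c
    rw [div_mul_eq_mul_div, lt_div_iff₀ hp1, sub_pos]
  have hden' : ∀ {c : ℝ}, p / (p - 1) * (N - 1) < c ↔ p * (N - 1) - c * (p - 1) < 0 := by
    intro c
    rw [div_mul_eq_mul_div, div_lt_iff₀ hp1, sub_neg]
  simp only [regionA, qStar, qStarStar, mem_ofPred_eq, lt_min_iff, max_lt_iff, mul_div_assoc'] at h
  rcases h with ⟨-, h1, ⟨h2, h3⟩, h4, h5⟩ | ⟨h1, ⟨h2, h3⟩, h4, h5⟩ | ⟨h1, h1', ⟨⟨h2, h3⟩, h4⟩, h5⟩ |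
    ⟨h1, ⟨⟨h2, h3⟩, h4⟩, h5⟩ | ⟨h1, ⟨⟨h2, h3⟩, h4⟩, h5⟩
  · rw [lt_div_iff₀ (by linarith)] at h4
    rw [lt_div_iff₀ (hden.1 (h1.trans hgap))] at h5
    exact ⟨h2, h3, h4, h5⟩
  · rw [lt_div_iff₀ (hden.1 (h1 ▸ hgap))] at h4
    refine ⟨h2, h3, ?_, h4⟩
    -- At `γ = N` the left side vanishes and the inequality reduces to the separate condition on
    -- `α`; the same happens to the other inequality at the second threshold.
    rw [h1, sub_self, mul_zero]
    exact mul_pos (by linarith) (by linarith)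
  · rw [div_lt_iff_of_neg (by linarith)] at h4
    rw [lt_div_iff₀ (hden.1 h1')] at h5
    exact ⟨h2, h3, h4, h5⟩
  · have hNγ : (N:ℝ) < γ := h1 ▸ hgap
    rw [div_lt_iff_of_neg (by linarith)] at h4
    refine ⟨h2, h3, h4, ?_⟩
    have e : p * (N - 1) = γ * (p - 1) := by
      rw [h1]; field_simp
    rw [e, sub_self, mul_zero]
    have : p * α + (1 - p * β) * γ + γ * (p - 1) = p * (α + (1 - β) * γ) := by ring
    rw [this]
    have : 0 < α + (1 - β) * γ := by linarith
    have hp0 : 0 < p := by linarith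
    positivity
  · rw [div_lt_iff_of_neg (by linarith)] at h4
    rw [div_lt_iff_of_neg (hden'.1 h1)] at h5
    exact ⟨h2, h3, h4, h5⟩

/-! ### The two estimates of `R0` -/

/-- Trading powers of `r` for powers of `V` by means of the lower bound on `V`. -/
theorem le_rpow_mul_rpow_add {k M D v : ℝ≥0∞} {r α β γ θ : ℝ} (hr : 0 < r) (hβ : 0 ≤ β)
    (hθ : 0 ≤ θ) (hk : k ≤ M * (ENNReal.ofReal (r ^ α) * v ^ β))
    (hv : ENNReal.ofReal (r ^ (-γ)) ≤ D * v) :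
    k ≤ M * D ^ θ * (ENNReal.ofReal (r ^ (α + γ * θ)) * v ^ (β + θ)) := by
  have h1 : 1 ≤ ENNReal.ofReal (r ^ γ) * (D * v) := by
    calc (1 : ℝ≥0∞) = ENNReal.ofReal (r ^ γ) * ENNReal.ofReal (r ^ (-γ)) := by
          rw [← ENNReal.ofReal_mul (by positivity), ← Real.rpow_add hr, add_neg_cancel,
            Real.rpow_zero, ENNReal.ofReal_one]
      _ ≤ _ := by gcongr
  have h2 : 1 ≤ (ENNReal.ofReal (r ^ γ) * (D * v)) ^ θ := by
    simpa using ENNReal.rpow_le_rpow h1 hθ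
  calc k ≤ M * (ENNReal.ofReal (r ^ α) * v ^ β) * 1 := by rwa [mul_one]
    _ ≤ M * (ENNReal.ofReal (r ^ α) * v ^ β) * (ENNReal.ofReal (r ^ γ) * (D * v)) ^ θ := by gcongr
    _ = M * D ^ θ * (ENNReal.ofReal (r ^ (α + γ * θ)) * v ^ (β + θ)) := by
        rw [ENNReal.mul_rpow_of_nonneg _ _ hθ, ENNReal.mul_rpow_of_nonneg _ _ hθ,
          ENNReal.rpow_add_of_nonneg _ _ hβ hθ, ENNReal.ofReal_rpow_of_nonneg (by positivity) hθ,
          ← Real.rpow_mul hr.le, Real.rpow_add hr, ENNReal.ofReal_mul (by positivity)]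
        ring

theorem lintegral_potential_le_one {p : ℝ} (hp : 0 < p) {V : ℝ → ℝ≥0∞} {u : Eucl N → ℝ}
    (hu : wNorm p V u = 1) (S : Set (Eucl N)) : ∫⁻ x in S, V ‖x‖ * ‖u x‖ₑ ^ p ≤ 1 := by
  rw [← lintegral_eq_one_of_wNorm_eq_one hp hu]
  exact (setLIntegral_le_lintegral _ _).trans (lintegral_mono fun x => le_add_self)

theorem aemeasurable_potential [Nontrivial (Eucl N)] {p : ℝ} {V : ℝ → ℝ≥0∞} (hV : HypV V)
    {u : Eucl N → ℝ} (hu : u ∈ W N p V) : AEMeasurable fun x => V ‖x‖ * ‖u x‖ₑ ^ p :=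
  (hV.aemeasurable.comp_quasiMeasurePreserving quasiMeasurePreserving_norm).mul
    (hu.1.1.aestronglyMeasurable.enorm.pow_const _)

/-- Estimate of `R0` for `p ≤ q`, through the pointwise bound of radial functions. -/
theorem exists_R0_le_of_le [Nontrivial (Eucl N)] {p α β γ q R₁ : ℝ} (hp : 1 < p) (hγ : p ≤ γ)
    (hβ₀ : 0 ≤ β) (hβ₁ : β ≤ 1) (hR₁ : 0 < R₁) {V : ℝ → ℝ≥0∞} {K : ℝ → ℝ} (hV : HypV V)
    {M D : ℝ≥0∞} (hM : M ≠ ⊤) (hD : D ≠ ⊤)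
    (hVD : ∀ᵐ x : Eucl N, ‖x‖ < R₁ → ENNReal.ofReal (‖x‖ ^ (-γ)) ≤ D * V ‖x‖)
    (hK : ∀ᵐ x : Eucl N, ‖x‖ < R₁ →
      ENNReal.ofReal (K ‖x‖) ≤ M * (ENNReal.ofReal (‖x‖ ^ α) * V ‖x‖ ^ β))
    (hpq : p ≤ q)
    (hq : q * (p * (N - 1) - γ * (p - 1)) < p * (p * α + (1 - p * β) * γ + p * (N - 1))) :
    ∃ (C : ℝ≥0∞) (e : ℝ), C ≠ ⊤ ∧ 0 < e ∧
      ∀ R, 0 < R → R < R₁ → R0 N p V K q R ≤ C * ENNReal.ofReal (R ^ e) := by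
  have hp0 : 0 < p := by linarith
  obtain ⟨C, hC, hCu⟩ := exists_pointwise_bound_Wr (N := N) hp hγ hR₁ hD hVD
  set κ : ℝ := (N:ℝ) - 1 - γ * (p - 1) / p with hκ
  -- The exponent of `|x|` left after raising `V^β` to `V` and bounding `|u|^(q-p)` pointwise; `p^2
  -- e` is the right side of `hq` minus its left side.
  set e : ℝ := α + γ * (1 - β) + -κ * ((q - p) / p) with he
  have he0 : 0 < e := by
    have : p ^ 2 * e = p * (p * α + (1 - p * β) * γ + p * (N - 1))
        - q * (p * (N - 1) - γ * (p - 1)) := by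
      rw [he, hκ]; field_simp; ring
    have h2 : 0 < p ^ 2 * e := by rw [this]; linarith
    exact pos_of_mul_pos_right h2 (by positivity)
  have hqp : 0 ≤ (q - p) / p := div_nonneg (by linarith) hp0.le
  set A := M * D ^ (1 - β) * C ^ ((q - p) / p) with hA
  have hAt : A ≠ ⊤ := by
    have h1 : D ^ (1 - β) ≠ ⊤ := ENNReal.rpow_ne_top_of_nonneg (by linarith) hD
    have h2 : C ^ ((q - p) / p) ≠ ⊤ := ENNReal.rpow_ne_top_of_nonneg hqp hC
    finiteness
  refine ⟨A * 2, e, by finiteness, he0, fun R hR hRR => ?_⟩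
  unfold R0
  refine iSup_le fun u => iSup_le fun h => iSup_le fun hu => iSup_le fun hh => iSup_le fun hun =>
    iSup_le fun hhn => ?_
  have hx0 : ∀ᵐ x : Eucl N, 0 < ‖x‖ := ae_of_ae_norm (ae_restrict_mem measurableSet_Ioi)
  calc ∫⁻ x in Metric.ball (0 : Eucl N) R,
        ENNReal.ofReal (K ‖x‖) * ‖u x‖ₑ ^ (q - 1) * ‖h x‖ₑ
      ≤ ∫⁻ x in Metric.ball (0 : Eucl N) R, A * ENNReal.ofReal (R ^ e) *
          (V ‖x‖ * ‖u x‖ₑ ^ p + V ‖x‖ * ‖h x‖ₑ ^ p) := by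
        refine lintegral_mono_ae ((ae_restrict_iff' measurableSet_ball).2 ?_)
        filter_upwards [hx0, hVD, hK, hCu u hu hun] with x hx hxV hxK hxu hxR
        have hxR' : ‖x‖ < R := by simpa using hxR
        have hxR₁ := hxR'.trans hRR
        have h1 := le_rpow_mul_rpow_add hx hβ₀ (θ := 1 - β) (by linarith) (hxK hxR₁) (hxV hxR₁)
        rw [add_sub_cancel, ENNReal.rpow_one] at h1
        have h2 : ‖u x‖ₑ ^ (q - p) ≤
            C ^ ((q - p) / p) * ENNReal.ofReal (‖x‖ ^ (-κ * ((q - p) / p))) := by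
          have h3 : ‖u x‖ₑ ^ p ≤ C * ENNReal.ofReal (‖x‖ ^ (-κ)) := by
            calc ‖u x‖ₑ ^ p = ENNReal.ofReal (‖x‖ ^ κ) * ‖u x‖ₑ ^ p *
                  ENNReal.ofReal (‖x‖ ^ (-κ)) := by
                  rw [mul_right_comm, ← ENNReal.ofReal_mul (by positivity), ← Real.rpow_add hx,
                    add_neg_cancel, Real.rpow_zero, ENNReal.ofReal_one, one_mul]
              _ ≤ _ := by gcongr; exact hxu hxR₁
          calc ‖u x‖ₑ ^ (q - p) = (‖u x‖ₑ ^ p) ^ ((q - p) / p) := by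
                rw [← ENNReal.rpow_mul, mul_div_cancel₀ _ hp0.ne']
            _ ≤ (C * ENNReal.ofReal (‖x‖ ^ (-κ))) ^ ((q - p) / p) := by gcongr
            _ = _ := by
                rw [ENNReal.mul_rpow_of_nonneg _ _ hqp,
                  ENNReal.ofReal_rpow_of_nonneg (by positivity) hqp, ← Real.rpow_mul hx.le]
        have h4 : ‖u x‖ₑ ^ (p - 1) * ‖h x‖ₑ ≤ ‖u x‖ₑ ^ p + ‖h x‖ₑ ^ p := by
          have h5 := rpow_mul_rpow_le_add (s := (p - 1) / p) (t := 1 / p)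
            (by apply div_nonneg <;> linarith) (by positivity) (by field_simp; ring)
            (‖u x‖ₑ ^ p) (‖h x‖ₑ ^ p)
          rwa [← ENNReal.rpow_mul, ← ENNReal.rpow_mul, mul_div_cancel₀ _ hp0.ne',
            mul_one_div_cancel hp0.ne', ENNReal.rpow_one] at h5
        have h6 : ENNReal.ofReal (‖x‖ ^ e) = ENNReal.ofReal (‖x‖ ^ (α + γ * (1 - β))) *
            ENNReal.ofReal (‖x‖ ^ (-κ * ((q - p) / p))) := by
          rw [← ENNReal.ofReal_mul (by positivity), ← Real.rpow_add hx]
        calc ENNReal.ofReal (K ‖x‖) * ‖u x‖ₑ ^ (q - 1) * ‖h x‖ₑ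
            = ENNReal.ofReal (K ‖x‖) * ‖u x‖ₑ ^ (q - p) * (‖u x‖ₑ ^ (p - 1) * ‖h x‖ₑ) := by
              rw [show q - 1 = (q - p) + (p - 1) by ring,
                ENNReal.rpow_add_of_nonneg _ _ (by linarith) (by linarith)]
              ring
          _ ≤ M * D ^ (1 - β) * (ENNReal.ofReal (‖x‖ ^ (α + γ * (1 - β))) * V ‖x‖) *
                (C ^ ((q - p) / p) * ENNReal.ofReal (‖x‖ ^ (-κ * ((q - p) / p)))) *
                (‖u x‖ₑ ^ p + ‖h x‖ₑ ^ p) := by gcongr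
          _ = A * ENNReal.ofReal (‖x‖ ^ e) * (V ‖x‖ * ‖u x‖ₑ ^ p + V ‖x‖ * ‖h x‖ₑ ^ p) := by
              rw [h6, hA]
              ring
          _ ≤ _ := by gcongr
    _ = A * ENNReal.ofReal (R ^ e) * ((∫⁻ x in Metric.ball (0 : Eucl N) R, V ‖x‖ * ‖u x‖ₑ ^ p) +
          ∫⁻ x in Metric.ball (0 : Eucl N) R, V ‖x‖ * ‖h x‖ₑ ^ p) := by
        rw [lintegral_const_mul' _ _ (by finiteness),
          lintegral_add_left' (aemeasurable_potential hV hu.1).restrict]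
    _ ≤ A * ENNReal.ofReal (R ^ e) * (1 + 1) := by
        gcongr
        · exact lintegral_potential_le_one hp0 hun _
        · exact lintegral_potential_le_one hp0 hhn _
    _ = _ := by rw [one_add_one_eq_two]; ring

/-- Estimate of `R0` for `q < p`, through Hölder's inequality. -/
theorem exists_R0_le_of_lt [Nontrivial (Eucl N)] {p α β γ q R₁ : ℝ} (hp : 1 < p)
    (hβ₀ : 0 ≤ β) {V : ℝ → ℝ≥0∞} {K : ℝ → ℝ} (hV : HypV V)
    {M D : ℝ≥0∞} (hM : M ≠ ⊤) (hD : D ≠ ⊤)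
    (hVD : ∀ᵐ x : Eucl N, ‖x‖ < R₁ → ENNReal.ofReal (‖x‖ ^ (-γ)) ≤ D * V ‖x‖)
    (hK : ∀ᵐ x : Eucl N, ‖x‖ < R₁ →
      ENNReal.ofReal (K ‖x‖) ≤ M * (ENNReal.ofReal (‖x‖ ^ α) * V ‖x‖ ^ β))
    (hq1 : 1 < q) (hqp : q < p) (hβq : p * β < q)
    (hq : q * (N - γ) < p * (α - γ * β + N)) :
    ∃ (C : ℝ≥0∞) (τ : ℝ), C ≠ ⊤ ∧ -(N:ℝ) < τ ∧
      ∀ R, 0 < R → R < R₁ → R0 N p V K q R ≤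
        C * (∫⁻ x in Metric.ball (0 : Eucl N) R, ENNReal.ofReal (‖x‖ ^ τ)) ^ ((p - q) / p) := by
  have hp0 : 0 < p := by linarith
  have hpq0 : 0 < p - q := by linarith
  -- Raises the exponent of `V` to `q/p = (q-1)/p + 1/p`, the amount that the Hölder factors with
  -- `u` and `h` absorb; `pβ < q` makes `θ` nonnegative.
  set θ : ℝ := q / p - β with hθ
  have hθ0 : 0 ≤ θ := by
    rw [hθ, sub_nonneg, le_div_iff₀ hp0]; linarith
  -- Chosen so that `|x|^τ` to the Hölder weight `(p-q)/p` is the remaining power `|x|^(α+γθ)`.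
  set τ : ℝ := (α + γ * θ) * (p / (p - q)) with hτ
  have hτN : -(N:ℝ) < τ := by
    have : τ = (p * (α - γ * β) + q * γ) / (p - q) := by
      rw [hτ, hθ]; field_simp; ring
    rw [this, lt_div_iff₀ hpq0]
    linarith
  refine ⟨M * D ^ θ, τ, ENNReal.mul_ne_top hM (ENNReal.rpow_ne_top_of_nonneg hθ0 hD), hτN,
    fun R hR hRR => ?_⟩
  unfold R0
  refine iSup_le fun u => iSup_le fun h => iSup_le fun hu => iSup_le fun hh => iSup_le fun hun =>
    iSup_le fun hhn => ?_
  have hx0 : ∀ᵐ x : Eucl N, 0 < ‖x‖ := ae_of_ae_norm (ae_restrict_mem measurableSet_Ioi)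
  let Φ : Fin 3 → Eucl N → ℝ≥0∞ := ![fun x => ENNReal.ofReal (‖x‖ ^ τ),
    fun x => V ‖x‖ * ‖u x‖ₑ ^ p, fun x => V ‖x‖ * ‖h x‖ₑ ^ p]
  let w : Fin 3 → ℝ := ![(p - q) / p, (q - 1) / p, 1 / p]
  have hΦ : ∀ i ∈ Finset.univ, AEMeasurable (Φ i) (volume.restrict (Metric.ball (0 : Eucl N) R)) := by
    intro i _
    fin_cases i
    · exact (by fun_prop : Measurable fun x : Eucl N => ENNReal.ofReal (‖x‖ ^ τ)).aemeasurable
    · exact (aemeasurable_potential hV hu.1).restrict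
    · exact (aemeasurable_potential hV hh).restrict
  have hw0 : ∀ i ∈ Finset.univ, 0 ≤ w i := by
    intro i _
    fin_cases i
    · exact div_nonneg hpq0.le hp0.le
    · exact div_nonneg (by linarith) hp0.le
    · exact div_nonneg zero_le_one hp0.le
  have hw1 : ∑ i, w i = 1 := by
    simp only [Fin.sum_univ_three, w, Matrix.cons_val]
    field_simp
    ring
  have hold := ENNReal.lintegral_prod_norm_pow_le Finset.univ hΦ hw1 hw0
  simp only [Fin.prod_univ_three, Φ, w, Matrix.cons_val] at hold
  calc ∫⁻ x in Metric.ball (0 : Eucl N) R,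
        ENNReal.ofReal (K ‖x‖) * ‖u x‖ₑ ^ (q - 1) * ‖h x‖ₑ
      ≤ ∫⁻ x in Metric.ball (0 : Eucl N) R, M * D ^ θ *
          (ENNReal.ofReal (‖x‖ ^ τ) ^ ((p - q) / p) * (V ‖x‖ * ‖u x‖ₑ ^ p) ^ ((q - 1) / p) *
            (V ‖x‖ * ‖h x‖ₑ ^ p) ^ (1 / p)) := by
        refine lintegral_mono_ae ((ae_restrict_iff' measurableSet_ball).2 ?_)
        filter_upwards [hx0, hVD, hK] with x hx hxV hxK hxR
        have hxR₁ : ‖x‖ < R₁ := lt_trans (by simpa using hxR) hRR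
        have h1 := le_rpow_mul_rpow_add hx hβ₀ hθ0 (hxK hxR₁) (hxV hxR₁)
        rw [hθ, add_sub_cancel, ← hθ] at h1
        have e1 : ENNReal.ofReal (‖x‖ ^ τ) ^ ((p - q) / p) =
            ENNReal.ofReal (‖x‖ ^ (α + γ * θ)) := by
          rw [ENNReal.ofReal_rpow_of_nonneg (by positivity) (by positivity), ← Real.rpow_mul hx.le,
            hτ]
          congr 2
          field_simp
        have e2 : (V ‖x‖ * ‖u x‖ₑ ^ p) ^ ((q - 1) / p) =
            V ‖x‖ ^ ((q - 1) / p) * ‖u x‖ₑ ^ (q - 1) := by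
          rw [ENNReal.mul_rpow_of_nonneg _ _ (div_nonneg (by linarith) hp0.le), ← ENNReal.rpow_mul,
            mul_div_cancel₀ _ hp0.ne']
        have e3 : (V ‖x‖ * ‖h x‖ₑ ^ p) ^ (1 / p) = V ‖x‖ ^ (1 / p) * ‖h x‖ₑ := by
          rw [ENNReal.mul_rpow_of_nonneg _ _ (by positivity), ← ENNReal.rpow_mul,
            mul_one_div_cancel hp0.ne', ENNReal.rpow_one]
        have e4 : V ‖x‖ ^ (q / p) = V ‖x‖ ^ ((q - 1) / p) * V ‖x‖ ^ (1 / p) := by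
          rw [← ENNReal.rpow_add_of_nonneg _ _ (div_nonneg (by linarith) hp0.le) (by positivity)]
          congr 1
          ring
        rw [e1, e2, e3]
        calc ENNReal.ofReal (K ‖x‖) * ‖u x‖ₑ ^ (q - 1) * ‖h x‖ₑ
            ≤ M * D ^ θ * (ENNReal.ofReal (‖x‖ ^ (α + γ * θ)) * V ‖x‖ ^ (q / p)) *
              ‖u x‖ₑ ^ (q - 1) * ‖h x‖ₑ := by gcongr
          _ = _ := by rw [e4]; ring
    _ = M * D ^ θ * ∫⁻ x in Metric.ball (0 : Eucl N) R,
          (ENNReal.ofReal (‖x‖ ^ τ) ^ ((p - q) / p) * (V ‖x‖ * ‖u x‖ₑ ^ p) ^ ((q - 1) / p) *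
            (V ‖x‖ * ‖h x‖ₑ ^ p) ^ (1 / p)) :=
        lintegral_const_mul' _ _ (ENNReal.mul_ne_top hM (ENNReal.rpow_ne_top_of_nonneg hθ0 hD))
    _ ≤ M * D ^ θ * ((∫⁻ x in Metric.ball (0 : Eucl N) R, ENNReal.ofReal (‖x‖ ^ τ)) ^ ((p - q) / p) *
          1 * 1) := by
        refine mul_le_mul_right (hold.trans ?_) _
        gcongr
        · exact ENNReal.rpow_le_one (lintegral_potential_le_one hp0 hun _)
            (div_nonneg (by linarith) hp0.le)
        · exact ENNReal.rpow_le_one (lintegral_potential_le_one hp0 hhn _) (by positivity)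
    _ = _ := by rw [mul_one, mul_one]

/-! ### Passage to the limit -/

/-- For `τ > -N` the power is integrable on the unit ball, and absolute continuity of the integral
applies to balls of vanishing volume. -/
theorem tendsto_lintegral_ball_norm_rpow [Nontrivial (Eucl N)] {τ : ℝ} (hτ : -(N:ℝ) < τ) :
    Tendsto (fun R : ℝ => ∫⁻ x in Metric.ball (0 : Eucl N) R, ENNReal.ofReal (‖x‖ ^ τ))
      (𝓝[>] 0) (𝓝 0) := by
  have hN : 1 ≤ N := by
    rcases Nat.eq_zero_or_pos N with rfl | h
    · exact absurd ‹Nontrivial (Eucl 0)› (not_nontrivial _)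
    · exact h
  have hint : IntegrableOn (fun x : Eucl N => ‖x‖ ^ τ) (Metric.ball 0 1) := by
    refine integrableOn_ball_of_norm_le_rpow (C := 1) (α := -τ) ?_ ?_ ?_ ?_
    · rwa [finrank_euclideanSpace_fin]
    · rw [finrank_euclideanSpace_fin]; linarith
    · refine Eventually.of_forall fun x => ?_
      rw [neg_neg, one_mul, Real.norm_of_nonneg (by positivity)]
    · exact (by fun_prop : Measurable fun x : Eucl N => ‖x‖ ^ τ).aestronglyMeasurable
  have hfin : ∫⁻ x in Metric.ball (0 : Eucl N) 1, ENNReal.ofReal (‖x‖ ^ τ) ≠ ⊤ := by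
    have h1 := hint.2
    rw [HasFiniteIntegral] at h1
    refine (lt_of_le_of_lt (lintegral_mono fun x => ?_) h1).ne
    rw [← ofReal_norm, Real.norm_of_nonneg (by positivity)]
  have hvol : Tendsto (fun R : ℝ => (volume.restrict (Metric.ball (0 : Eucl N) 1))
      (Metric.ball 0 R)) (𝓝[>] 0) (𝓝 0) := by
    have h1 : Tendsto (fun R : ℝ => ENNReal.ofReal (R ^ N) * volume (Metric.ball (0 : Eucl N) 1))
        (𝓝[>] 0) (𝓝 0) := by
      have h2 : Tendsto (fun R : ℝ => ENNReal.ofReal (R ^ N)) (𝓝 0) (𝓝 0) := by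
        have := (ENNReal.continuous_ofReal.comp (continuous_pow N)).tendsto (0:ℝ)
        simpa [Nat.ne_of_gt hN, Function.comp_def] using this
      have h3 := ENNReal.Tendsto.mul_const (b := volume (Metric.ball (0 : Eucl N) 1))
        (h2.mono_left (nhdsWithin_le_nhds (s := Ioi 0))) (Or.inr measure_ball_lt_top.ne)
      rwa [zero_mul] at h3
    refine tendsto_of_tendsto_of_tendsto_of_le_of_le' tendsto_const_nhds h1
      (Eventually.of_forall fun _ => zero_le) ?_
    filter_upwards [self_mem_nhdsWithin] with R hR
    refine (Measure.restrict_apply_le _ _).trans (le_of_eq ?_)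
    rw [Measure.addHaar_ball_of_pos _ _ hR, finrank_euclideanSpace_fin]
  have h := tendsto_setLIntegral_zero hfin hvol
  refine h.congr' ?_
  filter_upwards [Ioo_mem_nhdsGT one_pos] with R hR
  rw [Measure.restrict_restrict measurableSet_ball,
    inter_eq_left.2 (Metric.ball_subset_ball hR.2.le)]

end RadialCompactness

theorem mainTheorem5 (N : ℕ) (hN : 3 ≤ N) (p : ℝ) (hp : 1 < p) (hpN : p < N)
    (V : ℝ → ℝ≥0∞) (K : ℝ → ℝ)
    (hV : RadialCompactness.HypV V) (hK : RadialCompactness.HypK K)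
    (R₁ : ℝ) (hR₁ : 0 < R₁)
    (hVfin : ∀ᵐ r ∂(volume.restrict (Ioo 0 R₁)), V r < ⊤)
    (α₀ β₀ γ₀ : ℝ) (hβ₀ : 0 ≤ β₀) (hβ₁ : β₀ ≤ 1) (hγ₀ : p ≤ γ₀)
    (hsup : essSup (fun r : ℝ => ENNReal.ofReal (K r) / (ENNReal.ofReal (r ^ α₀) * V r ^ β₀))
      (volume.restrict (Ioo 0 R₁)) < ⊤)
    (hinf : 0 < essInf (fun r : ℝ => ENNReal.ofReal (r ^ γ₀) * V r)
      (volume.restrict (Ioo 0 R₁)))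
    (q₁ : ℝ) (hq₁ : (α₀, q₁) ∈ RadialCompactness.regionA N p β₀ γ₀) :
    Tendsto (fun R : ℝ => RadialCompactness.R0 N p V K q₁ R) (𝓝[>] 0) (𝓝 0) := by
  open RadialCompactness in
  have : Nonempty (Fin N) := ⟨⟨0, by omega⟩⟩
  have hnt : Nontrivial (Eucl N) := inferInstance
  obtain ⟨hq1, hβq, hst, hstst⟩ := inequalities_of_mem_regionA hp hpN hq₁
  -- The essential infimum may be infinite; a `c` strictly below it is finite and can be inverted.
  obtain ⟨c, hc0, hc⟩ := exists_between hinf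
  have hct : c ≠ ⊤ := (hc.trans_le le_top).ne
  have hVD : ∀ᵐ r ∂(volume.restrict (Ioo 0 R₁)),
      V r ≠ 0 ∧ ENNReal.ofReal (r ^ (-γ₀)) ≤ c⁻¹ * V r := by
    filter_upwards [ae_essInf_le (f := fun r : ℝ => ENNReal.ofReal (r ^ γ₀) * V r)
      (μ := volume.restrict (Ioo 0 R₁)), ae_restrict_mem measurableSet_Ioo] with r hr hrm
    have h1 : c ≤ ENNReal.ofReal (r ^ γ₀) * V r := hc.le.trans hr
    have hr0 : 0 < r := hrm.1
    refine ⟨fun h0 => hc0.not_ge (by simpa [h0] using h1), ?_⟩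
    calc ENNReal.ofReal (r ^ (-γ₀)) = c⁻¹ * c * ENNReal.ofReal (r ^ (-γ₀)) := by
          rw [ENNReal.inv_mul_cancel hc0.ne' hct, one_mul]
      _ ≤ c⁻¹ * (ENNReal.ofReal (r ^ γ₀) * V r) * ENNReal.ofReal (r ^ (-γ₀)) := by gcongr
      _ = c⁻¹ * V r * (ENNReal.ofReal (r ^ γ₀) * ENNReal.ofReal (r ^ (-γ₀))) := by ring
      _ = c⁻¹ * V r := by
          rw [← ENNReal.ofReal_mul (by positivity), ← Real.rpow_add hr0, add_neg_cancel,
            Real.rpow_zero, ENNReal.ofReal_one, mul_one]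
  set M := essSup (fun r : ℝ => ENNReal.ofReal (K r) / (ENNReal.ofReal (r ^ α₀) * V r ^ β₀))
      (volume.restrict (Ioo 0 R₁))
  have hKM : ∀ᵐ r ∂(volume.restrict (Ioo 0 R₁)),
      ENNReal.ofReal (K r) ≤ M * (ENNReal.ofReal (r ^ α₀) * V r ^ β₀) := by
    filter_upwards [ENNReal.ae_le_essSup (μ := volume.restrict (Ioo 0 R₁))
      (fun r : ℝ => ENNReal.ofReal (K r) / (ENNReal.ofReal (r ^ α₀) * V r ^ β₀)), hVD, hVfin,
      ae_restrict_mem measurableSet_Ioo] with r hr hrV hrf hrm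
    -- Clearing the quotient in `ℝ≥0∞` requires a denominator that is neither `0` nor `⊤`:
    -- positivity of `V` comes from the essential infimum, finiteness from `hVfin`.
    refine (ENNReal.div_le_iff (mul_ne_zero ?_ ?_) (ENNReal.mul_ne_top ENNReal.ofReal_ne_top ?_)).1
      hr
    · simpa using Real.rpow_pos_of_pos hrm.1 _
    · exact (ENNReal.rpow_pos (pos_iff_ne_zero.2 hrV.1) hrf.ne).ne'
    · exact ENNReal.rpow_ne_top_of_nonneg hβ₀ hrf.ne
  have hlift : ∀ Q : ℝ → Prop, (∀ᵐ r ∂(volume.restrict (Ioo 0 R₁)), Q r) →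
      ∀ᵐ x : Eucl N, ‖x‖ < R₁ → Q ‖x‖ := by
    intro Q hQ
    refine ae_of_ae_norm (Q := fun r => r < R₁ → Q r) ?_
    rw [ae_restrict_iff' measurableSet_Ioo] at hQ
    rw [ae_restrict_iff' measurableSet_Ioi]
    filter_upwards [hQ] with r hr h0 h1 using hr ⟨h0, h1⟩
  have hVD' := hlift _ (hVD.mono fun r hr => hr.2)
  have hKM' := hlift _ hKM
  have hct' : c⁻¹ ≠ ⊤ := ENNReal.inv_ne_top.2 hc0.ne'
  have hIoo : Ioo 0 R₁ ∈ 𝓝[>] (0:ℝ) := Ioo_mem_nhdsGT hR₁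
  rcases le_or_gt p q₁ with hpq | hpq
  · obtain ⟨C, e, hC, he, hbound⟩ := exists_R0_le_of_le hp hγ₀ hβ₀ hβ₁ hR₁ hV hsup.ne hct' hVD'
      hKM' hpq hstst
    have hlim : Tendsto (fun R : ℝ => C * ENNReal.ofReal (R ^ e)) (𝓝[>] 0) (𝓝 0) := by
      have h1 : Tendsto (fun R : ℝ => ENNReal.ofReal (R ^ e)) (𝓝 0) (𝓝 0) := by
        have := (ENNReal.continuous_ofReal.comp (Real.continuous_rpow_const he.le)).tendsto (0:ℝ)
        simpa [Real.zero_rpow he.ne', Function.comp_def] using this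
      have h2 := ENNReal.Tendsto.const_mul (a := C) (h1.mono_left (nhdsWithin_le_nhds (s := Ioi 0))) (Or.inr hC)
      rwa [mul_zero] at h2
    refine tendsto_of_tendsto_of_tendsto_of_le_of_le' tendsto_const_nhds hlim
      (Eventually.of_forall fun _ => zero_le) ?_
    filter_upwards [hIoo] with R hR using hbound R hR.1 hR.2
  · obtain ⟨C, τ, hC, hτ, hbound⟩ := exists_R0_le_of_lt hp hβ₀ hV hsup.ne hct' hVD' hKM' hq1 hpq
      hβq hst
    have hs : 0 < (p - q₁) / p := div_pos (by linarith) (by linarith)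
    have hlim : Tendsto (fun R : ℝ => C * (∫⁻ x in Metric.ball (0 : Eucl N) R,
        ENNReal.ofReal (‖x‖ ^ τ)) ^ ((p - q₁) / p)) (𝓝[>] 0) (𝓝 0) := by
      have h1 := (ENNReal.continuous_rpow_const (y := (p - q₁) / p)).continuousAt.tendsto.comp
        (tendsto_lintegral_ball_norm_rpow (N := N) hτ)
      rw [ENNReal.zero_rpow_of_pos hs] at h1
      have h2 := ENNReal.Tendsto.const_mul (a := C) h1 (Or.inr hC)
      rwa [mul_zero] at h2
    refine tendsto_of_tendsto_of_tendsto_of_le_of_le' tendsto_const_nhds hlim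
      (Eventually.of_forall fun _ => zero_le) ?_
    filter_upwards [hIoo] with R hR using hbound R hR.1 hR.2
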